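/- Let $t_0<T$, $d,k\in\mathbb N$, and consider the control system $$\dot x(t)=N_t(x(t))+B(t,x(t))\,u(t),\qquad x(t_0)=x^0\in\mathbb R^d,\quad t\in[t_0,T],$$ under the following assumptions. For every $x\in\mathbb R^d$ the map $t\mapsto N_t(x)\in\mathbb R^d$ belongs to $L^\infty(t_0,T)$; for every $t\in[t_0,T]$ the map $N_t$ is $C^2$ with $\|DN_t(x)\|\le\Lambda_1$ and $\|D^2N_t(x)\|\le\Lambda_2$ for all $x\in\mathbb R^d$, where $\Lambda_1,\Lambda_2>0$. Moreover $B\in L^\infty((t_0,T)\times\mathbb R^d;\mathbb R^{d\times k})$, for every $t\in[t_0,T]$ the map $B(t,\cdot)$ is $C^1$, and there is $L_B\ge0$ with $\|D_xB(t,x)\|\le L_B$ for all $(t,x)\in[t_0,T]\times\mathbb R^d$. Here $|\cdot|$ is the Euclidean norm and $\|\cdot\|$ the induced operator norm. For $s,t\in[t_0,T]$ let $\Phi_{s,t}$ be the flow of $N$: $\Phi_{s,t}(x)$ is the value at time $t$ of the (absolutely continuous) solution of $\dot z(r)=N_r(z(r))$ on $[t_0,T]$ with $z(s)=x$. For $u\in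 L^\infty((t_0,T);\mathbb R^k)$ let $x_u$ be the (absolutely continuous) solution of the control system. Put $\tau_1=t_0$, $\tau_2=T$, fix $i\in\{1,2\}$, and define $$L_{u,\tau_i}v=\int_{t_0}^T D\Phi_{t,\tau_i}(x_u(t))\,B(t,x_u(t))\,v(t)\,dt,\qquad v\in L^2((t_0,T);\mathbb R^k),$$ $$\mathcal N_i(u)=\int_{t_0}^T D\Phi_{t,\tau_i}(x_u(t))\,B(t,x_u(t))\,B(t,x_u(t))^\top D\Phi_{t,\tau_i}(x_u(t))^\top\,dt .$$ Given $C_i>0$ and $y_i\in\mathbb R^d$, let $\lambda_{\min}$ denote the smallest eigenvalue and set $$\mathcal F(C_i)=\{u\in L^\infty((t_0,T);\mathbb R^k):\ \lambda_{\min}(\mathcal N_i(u))\ge C_i^{-1}\},$$ $$\mathcal F(y_i)=\{u\in\mathcal F(C_i):\ \|u\|_\infty\le C_i\,\|B\|_\infty\,e^{\Lambda_1(T-t_0)}\,|y_i|\},\qquad \mathfrak F_i=\{u\in\mathcal F(y_i):\ L_{u,\tau_i}u=y_i\}.$$ Proposition. Assume $\mathcal F(C_i)\neq\emptyset$. Then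 $\mathfrak F_i$ is weakly sequentially closed in $L^2((t_0,T);\mathbb R^k)$. Consequently, if $\mathfrak F_i\neq\emptyset$, then $u\mapsto\tfrac12\|u\|_{L^2}^2$ attains its minimum on $\mathfrak F_i$. -/

import Mathlib

open MeasureTheory Set Filter Topology
open scoped ENNReal

noncomputable section

namespace ControlAffine

/-- The Euclidean space `ℝⁿ`. -/
abbrev Vec (n : ℕ) : Type := EuclideanSpace ℝ (Fin n)

/-- Real `d × k` matrices, identified with linear maps `ℝᵏ → ℝᵈ`; the norm is the spectral norm
and the adjoint is the transpose. -/
abbrev Mat (d k : ℕ) : Type := Vec k →L[ℝ] Vec d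

/-- Lebesgue measure on the open interval `(t₀, T)`. -/
abbrev timeMeasure (t₀ T : ℝ) : Measure ℝ := volume.restrict (Ioo t₀ T)

/-- The Hilbert space `L²((t₀, T); ℝᵏ)`. -/
abbrev L2Control (t₀ T : ℝ) (k : ℕ) : Type := Lp (Vec k) 2 (timeMeasure t₀ T)

/-- Standing assumptions on the drift `N`. -/
structure DriftAssumption {d : ℕ} (t₀ T : ℝ) (N : ℝ → Vec d → Vec d) (Λ₁ Λ₂ : ℝ) : Prop where
  Λ₁_pos : 0 < Λ₁
  Λ₂_pos : 0 < Λ₂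
  memLp_time : ∀ x, MemLp (fun t => N t x) ∞ (timeMeasure t₀ T)
  contDiff_space : ∀ t ∈ Icc t₀ T, ContDiff ℝ 2 (N t)
  norm_fderiv_le : ∀ t ∈ Icc t₀ T, ∀ x, ‖fderiv ℝ (N t) x‖ ≤ Λ₁
  norm_fderiv_fderiv_le : ∀ t ∈ Icc t₀ T, ∀ x, ‖fderiv ℝ (fderiv ℝ (N t)) x‖ ≤ Λ₂

/-- Standing assumptions on the input matrix `B`: it is in `L^∞((t₀, T) × ℝᵈ)`, and is `C¹` and
globally Lipschitz in the state, uniformly in time. -/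
structure InputAssumption {d k : ℕ} (t₀ T : ℝ) (B : ℝ → Vec d → Mat d k) : Prop where
  memLp : MemLp (fun p : ℝ × Vec d => B p.1 p.2) ∞ ((timeMeasure t₀ T).prod volume)
  contDiff_space : ∀ t ∈ Icc t₀ T, ContDiff ℝ 1 (B t)
  exists_norm_fderiv_le : ∃ L_B : ℝ, 0 ≤ L_B ∧
    ∀ t ∈ Icc t₀ T, ∀ x, ‖fderiv ℝ (B t) x‖ ≤ L_B

/-- `‖B‖_∞`, the norm of `B` in `L^∞((t₀, T) × ℝᵈ; ℝ^{d × k})`. -/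
def inputNorm {d k : ℕ} (t₀ T : ℝ) (B : ℝ → Vec d → Mat d k) : ℝ :=
  (eLpNorm (fun p : ℝ × Vec d => B p.1 p.2) ∞ ((timeMeasure t₀ T).prod volume)).toReal

/-- `y` is an absolutely continuous (Carathéodory) solution on `[t₀, T]` of `y' = f(t, y)`,
`y(s) = x`, in integral form. -/
def IsSolution {d : ℕ} (t₀ T : ℝ) (f : ℝ → Vec d → Vec d) (s : ℝ) (x : Vec d)
    (y : ℝ → Vec d) : Prop :=
  IntervalIntegrable (fun r => f r (y r)) volume t₀ T ∧
    ∀ t ∈ Icc t₀ T, y t = x + ∫ r in s..t, f r (y r)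

/-- The solution on `[t₀, T]` of `y' = f(t, y)`, `y(s) = x`. Under the standing assumptions it exists
and is unique on `[t₀, T]` for both vector fields used below; the values off `[t₀, T]` are never
used. -/
def solution {d : ℕ} (t₀ T : ℝ) (f : ℝ → Vec d → Vec d) (s : ℝ) (x : Vec d) : ℝ → Vec d :=
  Classical.epsilon (IsSolution t₀ T f s x)

/-- The flow `Φ_{s,t}` of the drift `N`: the value at time `t` of the solution of `y' = N_r(y)` that
starts from `x` at time `s` (forwards or backwards in time). -/
def flow {d : ℕ} (t₀ T : ℝ) (N : ℝ → Vec d → Vec d) (s t : ℝ) (x : Vec d) : Vec d :=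
  solution t₀ T N s x t

/-- The trajectory `x_u` of `x' = N_t(x) + B(t, x) u(t)`, `x(t₀) = x₀`. -/
def trajectory {d k : ℕ} (t₀ T : ℝ) (N : ℝ → Vec d → Vec d) (B : ℝ → Vec d → Mat d k)
    (x₀ : Vec d) (u : ℝ → Vec k) : ℝ → Vec d :=
  solution t₀ T (fun t x => N t x + B t x (u t)) t₀ x₀

/-- The kernel `t ↦ DΦ_{t,τ}(x_u(t)) B(t, x_u(t))`. -/
def kernel {d k : ℕ} (t₀ T : ℝ) (N : ℝ → Vec d → Vec d) (B : ℝ → Vec d → Mat d k)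
    (x₀ : Vec d) (τ : ℝ) (u : ℝ → Vec k) (t : ℝ) : Mat d k :=
  (fderiv ℝ (flow t₀ T N t τ) (trajectory t₀ T N B x₀ u t)).comp
    (B t (trajectory t₀ T N B x₀ u t))

/-- The operator `L_{u,τ} v = ∫ DΦ_{t,τ}(x_u(t)) B(t, x_u(t)) v(t) dt`. -/
def steeringOp {d k : ℕ} (t₀ T : ℝ) (N : ℝ → Vec d → Vec d) (B : ℝ → Vec d → Mat d k)
    (x₀ : Vec d) (τ : ℝ) (u v : ℝ → Vec k) : Vec d :=
  ∫ t, kernel t₀ T N B x₀ τ u t (v t) ∂(timeMeasure t₀ T)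

/-- The trajectory-dependent Gramian
`∫ DΦ_{t,τ}(x_u(t)) B(t, x_u(t)) B(t, x_u(t))ᵀ DΦ_{t,τ}(x_u(t))ᵀ dt`. -/
def gramian {d k : ℕ} (t₀ T : ℝ) (N : ℝ → Vec d → Vec d) (B : ℝ → Vec d → Mat d k)
    (x₀ : Vec d) (τ : ℝ) (u : ℝ → Vec k) : Mat d d :=
  ∫ t, (kernel t₀ T N B x₀ τ u t).comp
    (ContinuousLinearMap.adjoint (kernel t₀ T N B x₀ τ u t)) ∂(timeMeasure t₀ T)

/-- The smallest eigenvalue of a symmetric matrix. -/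
def lambdaMin {d : ℕ} (A : Mat d d) : ℝ :=
  sInf {c : ℝ | Module.End.HasEigenvalue (A : Vec d →ₗ[ℝ] Vec d) c}

/-- The two reference times `τ₁ = t₀` and `τ₂ = T`. -/
def refTime (t₀ T : ℝ) (i : Fin 2) : ℝ := ![t₀, T] i

/-- The feasible coercivity class: essentially bounded controls, as elements of `L²`, whose Gramian
has smallest eigenvalue at least `C⁻¹`. -/
def coercivityClass {d k : ℕ} (t₀ T : ℝ) (N : ℝ → Vec d → Vec d) (B : ℝ → Vec d → Mat d k)
    (x₀ : Vec d) (i : Fin 2) (C : ℝ) : Set (L2Control t₀ T k) :=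
  {u | MemLp u ∞ (timeMeasure t₀ T) ∧
    C⁻¹ ≤ lambdaMin (gramian t₀ T N B x₀ (refTime t₀ T i) u)}

/-- The radius `ζ(y) = C ‖B‖_∞ exp(Λ₁ (T - t₀)) |y|`. -/
def radius {d k : ℕ} (t₀ T : ℝ) (B : ℝ → Vec d → Mat d k) (Λ₁ C : ℝ) (y : Vec d) : ℝ :=
  C * inputNorm t₀ T B * Real.exp (Λ₁ * (T - t₀)) * ‖y‖

/-- The feasibility coercivity ball: the controls of the coercivity class with
`‖u‖_∞ ≤ ζ(y)`. -/
def coercivityBall {d k : ℕ} (t₀ T : ℝ) (N : ℝ → Vec d → Vec d) (B : ℝ → Vec d → Mat d k)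
    (x₀ : Vec d) (Λ₁ : ℝ) (i : Fin 2) (C : ℝ) (y : Vec d) : Set (L2Control t₀ T k) :=
  {u | u ∈ coercivityClass t₀ T N B x₀ i C ∧
    eLpNorm u ∞ (timeMeasure t₀ T) ≤ ENNReal.ofReal (radius t₀ T B Λ₁ C y)}

/-- The feasible set: the controls `u` of the coercivity ball with `L_{u,τᵢ} u = y`. -/
def feasibleSet {d k : ℕ} (t₀ T : ℝ) (N : ℝ → Vec d → Vec d) (B : ℝ → Vec d → Mat d k)
    (x₀ : Vec d) (Λ₁ : ℝ) (i : Fin 2) (C : ℝ) (y : Vec d) : Set (L2Control t₀ T k) :=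
  {u | u ∈ coercivityBall t₀ T N B x₀ Λ₁ i C y ∧
    steeringOp t₀ T N B x₀ (refTime t₀ T i) u u = y}

end ControlAffine

end

noncomputable section

namespace ControlAffine

/-! ### Grönwall's inequality in integral form -/

lemma le_of_le_add_integral {a b K : ℝ} {φ e : ℝ → ℝ} (hK : 0 ≤ K)
    (hφ : ContinuousOn φ (Icc a b)) (he : ContinuousOn e (Icc a b))
    (he0 : ∀ t ∈ Icc a b, 0 ≤ e t)
    (h : ∀ t ∈ Icc a b, φ t ≤ e t + K * ∫ r in a..t, φ r) {t : ℝ} (ht : t ∈ Icc a b) :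
    φ t ≤ e t + K * (Real.exp (K * (b - a)) * ∫ r in a..b, e r) := by
  have hab : a ≤ b := ht.1.trans ht.2
  set G : ℝ → ℝ := fun t => Real.exp (-K * (t - a)) * (∫ r in a..t, φ r) - ∫ r in a..t, e r with hG
  have prim : ∀ {ψ : ℝ → ℝ}, ContinuousOn ψ (Icc a b) →
      ContinuousOn (fun t => ∫ r in a..t, ψ r) (Icc a b) := fun {ψ} hψ => by
    have := intervalIntegral.continuousOn_primitive_interval (a := a) (b := b) (f := ψ)
      (μ := volume) (by rw [uIcc_of_le hab]; exact hψ.integrableOn_Icc)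
    rwa [uIcc_of_le hab] at this
  have der : ∀ {ψ : ℝ → ℝ}, ContinuousOn ψ (Icc a b) → ∀ t ∈ Ioo a b,
      HasDerivAt (fun t => ∫ r in a..t, ψ r) (ψ t) t := fun {ψ} hψ t ht => by
    refine intervalIntegral.integral_hasDerivAt_right ?_ ?_ ?_
    · exact (hψ.mono (by rw [uIcc_of_le ht.1.le]; exact Icc_subset_Icc_right ht.2.le)).intervalIntegrable
    · exact (hψ.mono Ioo_subset_Icc_self).stronglyMeasurableAtFilter isOpen_Ioo t ht
    · exact hψ.continuousAt (Icc_mem_nhds ht.1 ht.2)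
  have hanti : AntitoneOn G (Icc a b) := by
    refine antitoneOn_of_hasDerivWithinAt_nonpos (convex_Icc a b)
      (f' := fun t => -K * Real.exp (-K * (t - a)) * (∫ r in a..t, φ r)
        + Real.exp (-K * (t - a)) * φ t - e t) ?_ ?_ ?_
    · exact ((Continuous.continuousOn (by fun_prop)).mul (prim hφ)).sub (prim he)
    · intro t ht
      rw [interior_Icc] at ht
      have h1 : HasDerivAt (fun t => Real.exp (-K * (t - a))) (-K * Real.exp (-K * (t - a))) t := by
        have := (((hasDerivAt_id t).sub_const a).const_mul (-K)).exp
        simpa [mul_comm] using this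
      exact ((h1.mul (der hφ t ht)).sub (der he t ht)).hasDerivWithinAt
    · intro t ht
      rw [interior_Icc] at ht
      have ht' := Ioo_subset_Icc_self ht
      have h1 := h t ht'
      have h2 : Real.exp (-K * (t - a)) ≤ 1 :=
        Real.exp_le_one_iff.2 (by nlinarith [mul_nonneg hK (sub_nonneg.2 ht'.1)])
      have h3 := mul_le_mul_of_nonneg_left (sub_le_iff_le_add.2 h1)
        (Real.exp_pos (-K * (t - a))).le
      have h4 := mul_le_mul_of_nonneg_right h2 (he0 t ht')
      linarith
  have h0 : G t ≤ 0 := by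
    have := hanti (left_mem_Icc.2 hab) ht ht.1
    simpa [hG] using this
  have hint : ∫ r in a..t, e r ≤ ∫ r in a..b, e r := by
    refine intervalIntegral.integral_mono_interval le_rfl ht.1 ht.2 ?_ ?_
    · refine (ae_restrict_iff' measurableSet_Ioc).2 (ae_of_all _ fun r hr => ?_)
      exact he0 r (Ioc_subset_Icc_self hr)
    · exact (by rwa [uIcc_of_le hab] : ContinuousOn e (uIcc a b)).intervalIntegrable
  have hnn : 0 ≤ ∫ r in a..t, e r := intervalIntegral.integral_nonneg ht.1
    fun r hr => he0 r ⟨hr.1, hr.2.trans ht.2⟩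
  have hφint : ∫ r in a..t, φ r ≤ Real.exp (K * (b - a)) * ∫ r in a..b, e r := by
    have h1 : ∫ r in a..t, φ r ≤ Real.exp (K * (t - a)) * ∫ r in a..t, e r := by
      have h2 := mul_le_mul_of_nonneg_left (sub_nonpos.1 h0) (Real.exp_pos (K * (t - a))).le
      rwa [← mul_assoc, ← Real.exp_add, show K * (t - a) + -K * (t - a) = 0 by ring, Real.exp_zero,
        one_mul] at h2
    refine h1.trans (mul_le_mul ?_ hint hnn (Real.exp_pos _).le)
    exact Real.exp_le_exp.2 (mul_le_mul_of_nonneg_left (by linarith [ht.2]) hK)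
  exact (h t ht).trans (by gcongr)

/-- The constant of the two-sided Grönwall inequality. -/
def gronwallConst (K l : ℝ) : ℝ := 1 + K * (Real.exp (K * l) * l)

lemma gronwallConst_nonneg {K l : ℝ} (hK : 0 ≤ K) (hl : 0 ≤ l) : 0 ≤ gronwallConst K l := by
  unfold gronwallConst; positivity

lemma gronwallConst_mono {K l l' : ℝ} (hK : 0 ≤ K) (hl : 0 ≤ l) (h : l ≤ l') :
    gronwallConst K l ≤ gronwallConst K l' := by
  unfold gronwallConst; gcongr

lemma le_gronwallConst_mul {a b K c s : ℝ} {φ : ℝ → ℝ} (hK : 0 ≤ K) (hc : 0 ≤ c)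
    (hφ : ContinuousOn φ (Icc a b)) (hφ0 : ∀ t ∈ Icc a b, 0 ≤ φ t) (hs : s ∈ Icc a b)
    (h : ∀ t ∈ Icc a b, φ t ≤ c + K * |∫ r in s..t, φ r|) {t : ℝ} (ht : t ∈ Icc a b) :
    φ t ≤ gronwallConst K (b - a) * c := by
  have key : ∀ {l : ℝ}, 0 ≤ l → l ≤ b - a → c + K * (Real.exp (K * l) * (l * c)) ≤
      gronwallConst K (b - a) * c := fun {l} hl h' => by
    refine le_trans (le_of_eq ?_) (mul_le_mul_of_nonneg_right (gronwallConst_mono hK hl h') hc)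
    unfold gronwallConst; ring
  rcases le_total s t with hst | hts
  · have hsub : Icc s b ⊆ Icc a b := Icc_subset_Icc_left hs.1
    have := le_of_le_add_integral (a := s) (b := b) (φ := φ) (e := fun _ => c) hK (hφ.mono hsub)
      continuousOn_const (fun _ _ => hc) (fun r hr => ?_) ⟨hst, ht.2⟩
    · rw [intervalIntegral.integral_const, smul_eq_mul] at this
      exact this.trans (key (by linarith [hs.2]) (by linarith [hs.1]))
    · refine (h r (hsub hr)).trans_eq ?_
      rw [abs_of_nonneg]
      exact intervalIntegral.integral_nonneg hr.1 fun q hq => hφ0 q ⟨hs.1.trans hq.1, hq.2.trans hr.2⟩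
  · have hsub : ∀ r ∈ Icc (-s) (-a), -r ∈ Icc a b := fun r hr =>
      ⟨by linarith [hr.2], by linarith [hr.1, hs.2]⟩
    have := le_of_le_add_integral (a := -s) (b := -a) (φ := fun r => φ (-r)) (e := fun _ => c) hK
      (hφ.comp continuousOn_neg hsub)
      continuousOn_const (fun _ _ => hc) (fun r hr => ?_) (t := -t)
      ⟨by linarith, by linarith [ht.1]⟩
    · rw [intervalIntegral.integral_const, smul_eq_mul, neg_neg] at this
      exact this.trans (key (by linarith [hs.1]) (by linarith [hs.2]))
    · refine (h (-r) (hsub r hr)).trans_eq ?_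
      rw [intervalIntegral.integral_comp_neg (f := φ), neg_neg, intervalIntegral.integral_symm,
        abs_neg, abs_of_nonneg]
      exact intervalIntegral.integral_nonneg (by linarith [hr.1]) fun q hq =>
        hφ0 q ⟨(hsub r hr).1.trans hq.1, hq.2.trans hs.2⟩

/-! ### Carathéodory functions -/

lemma aestronglyMeasurable_comp_of_continuous {α E F : Type*} [MeasurableSpace α] {μ : Measure α}
    [TopologicalSpace E] [TopologicalSpace F] [TopologicalSpace.PseudoMetrizableSpace F] [AddCommMonoid F]
    [ContinuousAdd F]
    {f : α → E → F} (hf : ∀ x, AEStronglyMeasurable (fun t => f t x) μ)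
    (hc : ∀ᵐ t ∂μ, Continuous (f t)) {y : α → E} (hy : AEStronglyMeasurable y μ) :
    AEStronglyMeasurable (fun t => f t (y t)) μ := by
  have simple : ∀ s : SimpleFunc α E, AEStronglyMeasurable (fun t => f t (s t)) μ := fun s => by
    classical
    have : (fun t => f t (s t)) =
        fun t => ∑ c ∈ s.range, (s ⁻¹' {c}).indicator (fun t => f t c) t := by
      ext t
      rw [Finset.sum_eq_single (s t)]
      · simp
      · intro c _ hct
        exact indicator_of_notMem (fun h => hct (Eq.symm h)) _
      · intro h
        exact absurd (SimpleFunc.mem_range_self s t) h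
    rw [this]
    exact Finset.aestronglyMeasurable_fun_sum _ fun c _ => (hf c).indicator (s.measurableSet_preimage _)
  have hlim : AEStronglyMeasurable (fun t => f t (hy.mk y t)) μ := by
    refine aestronglyMeasurable_of_tendsto_ae atTop
      (fun n => simple (hy.stronglyMeasurable_mk.approx n)) ?_
    filter_upwards [hc] with t ht
    exact (ht.tendsto _).comp (hy.stronglyMeasurable_mk.tendsto_approx t)
  refine hlim.congr ?_
  filter_upwards [hy.ae_eq_mk] with t ht
  rw [ht]

section TimeMeasure

variable {t₀ T : ℝ}

lemma ae_restrict_uIoc {p : ℝ → Prop} (h : ∀ᵐ t ∂(timeMeasure t₀ T), p t) {s t : ℝ}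
    (hs : s ∈ Icc t₀ T) (ht : t ∈ Icc t₀ T) : ∀ᵐ r ∂(volume.restrict (uIoc s t)), p r := by
  have h' : ∀ᵐ t ∂(volume.restrict (Ioc t₀ T)), p t := by
    rwa [← Measure.restrict_congr_set Ioo_ae_eq_Ioc]
  exact ae_restrict_of_ae_restrict_of_subset
    (Ioc_subset_Ioc (le_min hs.1 ht.1) (max_le hs.2 ht.2)) h'

lemma intervalIntegrable_of_timeMeasure {E : Type*} [NormedAddCommGroup E] {f : ℝ → E}
    (h : Integrable f (timeMeasure t₀ T)) {s t : ℝ} (hs : s ∈ Icc t₀ T) (ht : t ∈ Icc t₀ T) :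
    IntervalIntegrable f volume s t := by
  have h1 : IntegrableOn f (Ioc t₀ T) volume :=
    (integrableOn_Ioc_iff_integrableOn_Ioo (by simp)).2 h
  rw [intervalIntegrable_iff]
  exact h1.mono_set (Ioc_subset_Ioc (le_min hs.1 ht.1) (max_le hs.2 ht.2))

lemma integrable_timeMeasure_iff {E : Type*} [NormedAddCommGroup E] (hT : t₀ ≤ T) {f : ℝ → E} :
    Integrable f (timeMeasure t₀ T) ↔ IntervalIntegrable f volume t₀ T := by
  rw [intervalIntegrable_iff_integrableOn_Ioo_of_le hT, IntegrableOn]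

lemma aestronglyMeasurable_of_continuousOn {E : Type*} [TopologicalSpace E]
    [TopologicalSpace.PseudoMetrizableSpace E] {y : ℝ → E} (hy : ContinuousOn y (Icc t₀ T)) :
    AEStronglyMeasurable y (timeMeasure t₀ T) := by
  have h := hy.aestronglyMeasurable_of_isCompact isCompact_Icc measurableSet_Icc (μ := volume)
  exact h.mono_measure (Measure.restrict_mono Ioo_subset_Icc_self le_rfl)

lemma ae_mem_Icc : ∀ᵐ t ∂(timeMeasure t₀ T), t ∈ Icc t₀ T :=
  (ae_restrict_iff' measurableSet_Ioo).2 (ae_of_all _ fun _ h => Ioo_subset_Icc_self h)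

end TimeMeasure

/-! ### Carathéodory vector fields: existence, uniqueness and stability -/

/-- A Carathéodory vector field that is `K`-Lipschitz in the state and bounded by `M` at the
origin, for almost every time. -/
structure CaratheodoryField {d : ℕ} (t₀ T : ℝ) (f : ℝ → Vec d → Vec d) (K M : ℝ) : Prop where
  nonneg : 0 ≤ K
  aestronglyMeasurable : ∀ x, AEStronglyMeasurable (fun t => f t x) (timeMeasure t₀ T)
  lipschitz : ∀ᵐ t ∂(timeMeasure t₀ T), ∀ x y, ‖f t x - f t y‖ ≤ K * ‖x - y‖
  bound : ∀ᵐ t ∂(timeMeasure t₀ T), ‖f t 0‖ ≤ M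

section Field

variable {d : ℕ} {t₀ T K M : ℝ} {f : ℝ → Vec d → Vec d}

lemma continuous_of_norm_sub_le {E F : Type*} [NormedAddCommGroup E] [NormedAddCommGroup F]
    {g : E → F} {K : ℝ} (hg : ∀ x y, ‖g x - g y‖ ≤ K * ‖x - y‖) : Continuous g :=
  (LipschitzWith.of_dist_le' (K := K) fun x y => by
    simpa only [dist_eq_norm] using hg x y).continuous

lemma CaratheodoryField.aestronglyMeasurable_comp (hf : CaratheodoryField t₀ T f K M)
    {y : ℝ → Vec d} (hy : ContinuousOn y (Icc t₀ T)) :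
    AEStronglyMeasurable (fun r => f r (y r)) (timeMeasure t₀ T) :=
  aestronglyMeasurable_comp_of_continuous hf.aestronglyMeasurable
    (hf.lipschitz.mono fun _ => continuous_of_norm_sub_le) (aestronglyMeasurable_of_continuousOn hy)

lemma CaratheodoryField.integrable_comp (hf : CaratheodoryField t₀ T f K M)
    {y : ℝ → Vec d} (hy : ContinuousOn y (Icc t₀ T)) :
    Integrable (fun r => f r (y r)) (timeMeasure t₀ T) := by
  obtain ⟨Y, hY⟩ := isCompact_Icc.exists_bound_of_continuousOn hy
  refine Integrable.of_bound (hf.aestronglyMeasurable_comp hy) (M + K * Y) ?_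
  filter_upwards [hf.lipschitz, hf.bound, ae_mem_Icc] with t h1 h2 h3
  have h4 := h1 (y t) 0
  rw [sub_zero] at h4
  calc ‖f t (y t)‖ = ‖f t 0 + (f t (y t) - f t 0)‖ := by rw [add_sub_cancel]
    _ ≤ ‖f t 0‖ + ‖f t (y t) - f t 0‖ := norm_add_le _ _
    _ ≤ M + K * Y := add_le_add h2 (h4.trans (mul_le_mul_of_nonneg_left (hY t h3) hf.nonneg))

lemma CaratheodoryField.intervalIntegrable_comp (hf : CaratheodoryField t₀ T f K M)
    {y : ℝ → Vec d} (hy : ContinuousOn y (Icc t₀ T)) {s t : ℝ} (hs : s ∈ Icc t₀ T)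
    (ht : t ∈ Icc t₀ T) : IntervalIntegrable (fun r => f r (y r)) volume s t :=
  intervalIntegrable_of_timeMeasure (hf.integrable_comp hy) hs ht

lemma continuousOn_integral {E : Type*} [NormedAddCommGroup E] [NormedSpace ℝ E] {g : ℝ → E}
    {s : ℝ} (hs : s ∈ Icc t₀ T) (hg : IntervalIntegrable g volume t₀ T) :
    ContinuousOn (fun t => ∫ r in s..t, g r) (Icc t₀ T) := by
  have hT := hs.1.trans hs.2
  have := intervalIntegral.continuousOn_primitive_interval' (μ := volume) hg
    (by rwa [uIcc_of_le hT] : s ∈ uIcc t₀ T)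
  rwa [uIcc_of_le hT] at this

lemma norm_integral_sub_le {g h : ℝ → Vec d} {φ : ℝ → ℝ} {s t : ℝ}
    (hs : s ∈ Icc t₀ T) (ht : t ∈ Icc t₀ T)
    (hg : IntervalIntegrable g volume s t) (hh : IntervalIntegrable h volume s t)
    (hφ : ContinuousOn φ (Icc t₀ T))
    (hle : ∀ᵐ r ∂(timeMeasure t₀ T), ‖g r - h r‖ ≤ φ r) :
    ‖(∫ r in s..t, g r) - ∫ r in s..t, h r‖ ≤ |∫ r in s..t, φ r| := by
  rw [← intervalIntegral.integral_sub hg hh]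
  refine intervalIntegral.norm_integral_le_abs_of_norm_le (ae_restrict_uIoc hle hs ht) ?_
  exact (hφ.mono (uIcc_subset_Icc hs ht)).intervalIntegrable

/-- The Picard operator on continuous curves. -/
def picard (f : ℝ → Vec d → Vec d) (hf : CaratheodoryField t₀ T f K M) (s : Icc t₀ T) (x : Vec d)
    (y : C(Icc t₀ T, Vec d)) : C(Icc t₀ T, Vec d) where
  toFun t := x + ∫ r in (s : ℝ)..t, f r (IccExtend (s.2.1.trans s.2.2) y r)
  continuous_toFun := by
    have hT := s.2.1.trans s.2.2
    have hy : ContinuousOn (IccExtend hT y) (Icc t₀ T) := y.continuous.Icc_extend'.continuousOn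
    have h := continuousOn_integral s.2 (hf.intervalIntegrable_comp hy (left_mem_Icc.2 hT)
      (right_mem_Icc.2 hT))
    exact continuous_const.add (continuousOn_iff_continuous_domRestrict.1 h)

lemma norm_picard_iterate_sub_le (hf : CaratheodoryField t₀ T f K M) (s : Icc t₀ T) (x : Vec d)
    (y z : C(Icc t₀ T, Vec d)) (n : ℕ) (t : Icc t₀ T) :
    ‖(picard f hf s x)^[n] y t - (picard f hf s x)^[n] z t‖ ≤
      (K * |(t : ℝ) - s|) ^ n / n.factorial * dist y z := by
  have hT := s.2.1.trans s.2.2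
  induction n generalizing t with
  | zero => simpa [dist_eq_norm] using ContinuousMap.dist_apply_le_dist (f := y) (g := z) t
  | succ n ih =>
    rw [Function.iterate_succ_apply', Function.iterate_succ_apply']
    set Y := (picard f hf s x)^[n] y
    set Z := (picard f hf s x)^[n] z
    have hY : ContinuousOn (IccExtend hT Y) (Icc t₀ T) := Y.continuous.Icc_extend'.continuousOn
    have hZ : ContinuousOn (IccExtend hT Z) (Icc t₀ T) := Z.continuous.Icc_extend'.continuousOn
    change ‖(x + ∫ r in (s : ℝ)..t, f r (IccExtend hT Y r)) -
      (x + ∫ r in (s : ℝ)..t, f r (IccExtend hT Z r))‖ ≤ _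
    rw [add_sub_add_left_eq_sub]
    refine (norm_integral_sub_le s.2 t.2 (hf.intervalIntegrable_comp hY s.2 t.2)
      (hf.intervalIntegrable_comp hZ s.2 t.2)
      (φ := fun r => K ^ (n + 1) / n.factorial * dist y z * |r - s| ^ n) (by fun_prop) ?_).trans_eq ?_
    · filter_upwards [hf.lipschitz, ae_mem_Icc] with r h1 h2
      refine (h1 _ _).trans ?_
      rw [IccExtend_of_mem hT Y h2, IccExtend_of_mem hT Z h2]
      refine (mul_le_mul_of_nonneg_left (ih ⟨r, h2⟩) hf.nonneg).trans_eq ?_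
      simp only [mul_pow, pow_succ]
      ring
    · rw [intervalIntegral.integral_const_mul, abs_mul, intervalIntegral.abs_intervalIntegral_eq,
        integral_pow_abs_sub_uIoc, abs_of_nonneg (by have := hf.nonneg; positivity),
        abs_of_nonneg (by positivity), Nat.factorial_succ, mul_pow]
      push_cast
      field_simp

lemma CaratheodoryField.exists_isSolution (hf : CaratheodoryField t₀ T f K M) {s : ℝ}
    (hs : s ∈ Icc t₀ T) (x : Vec d) : ∃ y, IsSolution t₀ T f s x y := by
  have hT := hs.1.trans hs.2
  set P := picard f hf ⟨s, hs⟩ x with hP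
  obtain ⟨n, hn⟩ : ∃ n : ℕ, (K * (T - t₀)) ^ n / n.factorial < 1 :=
    ((FloorSemiring.tendsto_pow_div_factorial_atTop (K * (T - t₀))).eventually
      (gt_mem_nhds one_pos)).exists
  have h0 : 0 ≤ (K * (T - t₀)) ^ n / n.factorial := by
    have := mul_nonneg hf.nonneg (sub_nonneg.2 hT); positivity
  have hcon : ContractingWith ⟨(K * (T - t₀)) ^ n / n.factorial, h0⟩ P^[n] := by
    refine ⟨by exact_mod_cast hn, LipschitzWith.of_dist_le_mul fun y z => ?_⟩
    refine (ContinuousMap.dist_le (by positivity)).2 fun t => ?_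
    rw [dist_eq_norm]
    refine (norm_picard_iterate_sub_le hf ⟨s, hs⟩ x y z n t).trans ?_
    have h1 : |(t : ℝ) - s| ≤ T - t₀ := by
      rw [abs_le]; exact ⟨by linarith [t.2.1, hs.2], by linarith [t.2.2, hs.1]⟩
    have := hf.nonneg
    change _ ≤ (K * (T - t₀)) ^ n / n.factorial * dist y z
    gcongr
  set y := ContractingWith.fixedPoint P^[n] hcon
  have hy : P y = y := hcon.isFixedPt_fixedPoint_iterate
  have hyc : ContinuousOn (IccExtend hT y) (Icc t₀ T) := y.continuous.Icc_extend'.continuousOn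
  refine ⟨IccExtend hT y, hf.intervalIntegrable_comp hyc (left_mem_Icc.2 hT) (right_mem_Icc.2 hT),
    fun t ht => ?_⟩
  rw [IccExtend_of_mem hT y ht]
  conv_lhs => rw [← hy]
  rfl

namespace IsSolution

variable {s s' : ℝ} {x x' : Vec d} {y z : ℝ → Vec d}

lemma continuousOn (hs : s ∈ Icc t₀ T) (hy : IsSolution t₀ T f s x y) :
    ContinuousOn y (Icc t₀ T) :=
  (continuousOn_const.add (continuousOn_integral hs hy.1)).congr hy.2

lemma apply_self (hs : s ∈ Icc t₀ T) (hy : IsSolution t₀ T f s x y) : y s = x := by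
  simpa using hy.2 s hs

lemma intervalIntegrable (hy : IsSolution t₀ T f s x y) {r t : ℝ} (hr : r ∈ Icc t₀ T)
    (ht : t ∈ Icc t₀ T) : IntervalIntegrable (fun r => f r (y r)) volume r t :=
  hy.1.mono_set (by rw [uIcc_of_le (hr.1.trans hr.2)]; exact uIcc_subset_Icc hr ht)

lemma eq_add_integral (hs : s ∈ Icc t₀ T) (hy : IsSolution t₀ T f s x y) {r t : ℝ}
    (hr : r ∈ Icc t₀ T) (ht : t ∈ Icc t₀ T) : y t = y r + ∫ q in r..t, f q (y q) := by
  rw [hy.2 t ht, hy.2 r hr, add_assoc, intervalIntegral.integral_add_adjacent_intervals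
    (hy.intervalIntegrable hs hr) (hy.intervalIntegrable hr ht)]

lemma norm_sub_le (hf : CaratheodoryField t₀ T f K M) (hs : s ∈ Icc t₀ T) (hs' : s' ∈ Icc t₀ T)
    (hy : IsSolution t₀ T f s x y) (hz : IsSolution t₀ T f s' x' z) {r t : ℝ} (hr : r ∈ Icc t₀ T)
    (ht : t ∈ Icc t₀ T) : ‖y t - z t‖ ≤ gronwallConst K (T - t₀) * ‖y r - z r‖ := by
  have hc : ContinuousOn (fun t => ‖y t - z t‖) (Icc t₀ T) :=
    ((hy.continuousOn hs).sub (hz.continuousOn hs')).norm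
  refine le_gronwallConst_mul (φ := fun t => ‖y t - z t‖) hf.nonneg (norm_nonneg _) hc
    (fun _ _ => norm_nonneg _) hr (fun q hq => ?_) ht
  rw [hy.eq_add_integral hs hr hq, hz.eq_add_integral hs' hr hq, add_sub_add_comm]
  refine (norm_add_le _ _).trans (add_le_add le_rfl ?_)
  rw [← abs_of_nonneg hf.nonneg, ← abs_mul,
    ← intervalIntegral.integral_const_mul]
  exact norm_integral_sub_le hr hq (hy.intervalIntegrable hr hq) (hz.intervalIntegrable hr hq)
    (continuousOn_const.mul hc) (hf.lipschitz.mono fun _ h => h _ _)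

end IsSolution

lemma CaratheodoryField.isSolution_solution (hf : CaratheodoryField t₀ T f K M) {s : ℝ}
    (hs : s ∈ Icc t₀ T) (x : Vec d) : IsSolution t₀ T f s x (solution t₀ T f s x) :=
  Classical.epsilon_spec (hf.exists_isSolution hs x)

end Field

/-! ### Differentiability from a bound on the mixed second differences -/

section MixedDifference

variable {E F : Type*} [NormedAddCommGroup E] [NormedSpace ℝ E] [NormedAddCommGroup F]
  [NormedSpace ℝ F] {g : E → F} {G C : ℝ}

lemma exists_hasFDerivAt_of_mixed_difference_le [CompleteSpace F]
    (hlip : ∀ x y, ‖g x - g y‖ ≤ G * ‖x - y‖)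
    (hmix : ∀ x h k, ‖g (x + h + k) - g (x + h) - g (x + k) + g x‖ ≤ C * ‖h‖ * ‖k‖) (x : E) :
    ∃ A : E →L[ℝ] F, HasFDerivAt g A x := by
  set D : ℕ → E → F := fun n h => (2 : ℝ) ^ n • (g (x + ((2 : ℝ) ^ n)⁻¹ • h) - g x) with hD
  have hcauchy : ∀ h n, dist (D n h) (D (n + 1) h) ≤ C * ‖h‖ ^ 2 / 2 / 2 / 2 ^ n := fun h n => by
    set p : E := ((2 : ℝ) ^ (n + 1))⁻¹ • h with hp
    have h2 : ((2 : ℝ) ^ n)⁻¹ • h = p + p := by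
      rw [hp, ← two_smul ℝ, smul_smul, pow_succ]; congr 1; field_simp
    have h3 : D n h - D (n + 1) h = (2 : ℝ) ^ n • (g (x + p + p) - g (x + p) - g (x + p) + g x) := by
      simp only [hD, h2, pow_succ, mul_smul, ← smul_sub, two_smul, add_assoc]
      congr 1; abel
    rw [dist_eq_norm, h3, norm_smul, Real.norm_of_nonneg (by positivity)]
    refine (mul_le_mul_of_nonneg_left (hmix x p p) (by positivity)).trans_eq ?_
    rw [hp, norm_smul, Real.norm_of_nonneg (by positivity)]
    field_simp
    ring
  have hlim : ∀ h, ∃ v, Tendsto (fun n => D n h) atTop (𝓝 v) := fun h =>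
    cauchySeq_tendsto_of_complete (cauchySeq_of_le_geometric_two (hcauchy h))
  choose A hA using hlim
  have hbound : ∀ h, ‖g (x + h) - g x - A h‖ ≤ C * ‖h‖ ^ 2 / 2 := fun h => by
    have := dist_le_of_le_geometric_two_of_tendsto₀ (hcauchy h) (hA h)
    simpa [hD, dist_eq_norm] using this
  have hadd : ∀ h k, A (h + k) = A h + A k := fun h k => by
    have h1 : Tendsto (fun n => D n (h + k) - D n h - D n k) atTop (𝓝 (A (h + k) - A h - A k)) :=
      ((hA _).sub (hA _)).sub (hA _)
    have h2 : Tendsto (fun n => D n (h + k) - D n h - D n k) atTop (𝓝 0) := by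
      refine squeeze_zero_norm (a := fun n => C * ‖h‖ * ‖k‖ * (1 / 2) ^ n) (fun n => ?_) ?_
      · set q : ℝ := ((2 : ℝ) ^ n)⁻¹
        have h3 : D n (h + k) - D n h - D n k = (2 : ℝ) ^ n • (g (x + q • h + q • k) - g (x + q • h)
            - g (x + q • k) + g x) := by
          simp only [hD, ← smul_sub]
          rw [smul_add ((2 : ℝ) ^ n)⁻¹ h k, ← add_assoc x]
          congr 1
          abel
        rw [h3, norm_smul, Real.norm_of_nonneg (by positivity)]
        refine (mul_le_mul_of_nonneg_left (hmix x _ _) (by positivity)).trans_eq ?_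
        rw [norm_smul, norm_smul, Real.norm_of_nonneg (by positivity)]
        simp only [q, one_div, inv_pow]
        field_simp
      · simpa using (tendsto_pow_atTop_nhds_zero_of_lt_one (by norm_num : (0 : ℝ) ≤ 1 / 2)
          (by norm_num)).const_mul (C * ‖h‖ * ‖k‖)
    have := tendsto_nhds_unique h1 h2
    rwa [sub_sub, sub_eq_zero] at this
  have hAlip : ∀ h k, ‖A h - A k‖ ≤ G * ‖h - k‖ := fun h k => by
    refine le_of_tendsto ((hA h).sub (hA k)).norm (Eventually.of_forall fun n => ?_)
    simp only [hD]
    rw [← smul_sub, sub_sub_sub_cancel_right, norm_smul, Real.norm_of_nonneg (by positivity)]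
    refine (mul_le_mul_of_nonneg_left (hlip _ _) (by positivity)).trans_eq ?_
    rw [add_sub_add_left_eq_sub, ← smul_sub, norm_smul, Real.norm_of_nonneg (by positivity)]
    field_simp
  let L : E →L[ℝ] F := (AddMonoidHom.mk' A hadd).toRealLinearMap (continuous_of_norm_sub_le hAlip)
  refine ⟨L, .of_isLittleO ?_⟩
  have hO : (fun y => g y - g x - L (y - x)) =O[𝓝 x] fun y => ‖y - x‖ ^ 2 := by
    refine Asymptotics.IsBigO.of_bound (C / 2) (Eventually.of_forall fun y => ?_)
    have := hbound (y - x)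
    rw [add_sub_cancel] at this
    rw [Real.norm_of_nonneg (by positivity)]
    exact this.trans_eq (by ring)
  refine hO.trans_isLittleO ?_
  have := (Asymptotics.isLittleO_pow_id (𝕜 := ℝ) one_lt_two).comp_tendsto
    (show Tendsto (fun y => ‖y - x‖) (𝓝 x) (𝓝 0) from tendsto_norm_sub_self x)
  exact this.norm_right.congr (fun _ => rfl) (fun _ => by simp) |>.of_norm_right

lemma norm_fderiv_sub_le_of_mixed_difference_le (hd : Differentiable ℝ g) (hC : 0 ≤ C)
    (hmix : ∀ x h k, ‖g (x + h + k) - g (x + h) - g (x + k) + g x‖ ≤ C * ‖h‖ * ‖k‖) (x y : E) :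
    ‖fderiv ℝ g x - fderiv ℝ g y‖ ≤ C * ‖x - y‖ := by
  have hshift : ∀ z : E, HasFDerivAt (fun k => g (z + k)) (fderiv ℝ g z) 0 := fun z => by
    have h1 : HasFDerivAt g (fderiv ℝ g z) (z + 0) := by rw [add_zero]; exact (hd z).hasFDerivAt
    simpa [Function.comp_def] using h1.comp (0 : E) ((hasFDerivAt_id (0 : E)).const_add z)
  refine ((hshift x).sub (hshift y)).le_of_lip' (by positivity) (Eventually.of_forall fun k => ?_)
  have := hmix y (x - y) k
  simp only [add_sub_cancel] at this
  simp only [Pi.sub_apply, add_zero, sub_zero]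
  refine le_trans (le_of_eq ?_) this
  congr 1; abel

end MixedDifference

/-! ### The flow of the drift -/

lemma aestronglyMeasurable_of_forall_apply {α F : Type*} [MeasurableSpace α] {μ : Measure α}
    [NormedAddCommGroup F] [NormedSpace ℝ F] {n : ℕ} {A : α → Vec n →L[ℝ] F}
    (hA : ∀ v, AEStronglyMeasurable (fun a => A a v) μ) : AEStronglyMeasurable A μ := by
  set b := EuclideanSpace.basisFun (Fin n) ℝ
  have : A = fun a => ∑ i, ContinuousLinearMap.smulRightL ℝ (Vec n) F (innerSL ℝ (b i)) (A a (b i)) := by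
    ext a v
    conv_lhs => rw [← b.sum_repr' v]
    simp
  rw [this]
  exact Finset.aestronglyMeasurable_fun_sum _ fun i _ =>
    (ContinuousLinearMap.smulRightL ℝ (Vec n) F
      (innerSL ℝ (b i))).continuous.comp_aestronglyMeasurable (hA _)

section Flow

variable {d : ℕ} {t₀ T Λ₁ Λ₂ : ℝ} {N : ℝ → Vec d → Vec d}

lemma norm_sub_le_of_norm_fderiv_le {E F : Type*} [NormedAddCommGroup E] [NormedSpace ℝ E]
    [NormedAddCommGroup F] [NormedSpace ℝ F] {g : E → F} {L : ℝ} (hg : Differentiable ℝ g)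
    (hL : ∀ x, ‖fderiv ℝ g x‖ ≤ L) (x y : E) : ‖g x - g y‖ ≤ L * ‖x - y‖ :=
  convex_univ.norm_image_sub_le_of_norm_fderiv_le (fun x _ => hg x) (fun x _ => hL x)
    (mem_univ y) (mem_univ x)

namespace DriftAssumption

lemma exists_caratheodoryField (hN : DriftAssumption t₀ T N Λ₁ Λ₂) :
    ∃ M, CaratheodoryField t₀ T N Λ₁ M := by
  refine ⟨(eLpNorm (fun t => N t 0) ∞ (timeMeasure t₀ T)).toReal, hN.Λ₁_pos.le,
    fun x => (hN.memLp_time x).1, ?_, ?_⟩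
  · filter_upwards [ae_mem_Icc] with t ht
    exact norm_sub_le_of_norm_fderiv_le ((hN.contDiff_space t ht).differentiable (by norm_num))
      (hN.norm_fderiv_le t ht)
  · have h := hN.memLp_time 0
    filter_upwards [ae_le_eLpNormEssSup (f := fun t => N t 0) (μ := timeMeasure t₀ T)] with t ht
    rw [← toReal_enorm]
    refine ENNReal.toReal_mono h.2.ne ?_
    rwa [eLpNorm_exponent_top]

lemma norm_mixed_difference_le (hN : DriftAssumption t₀ T N Λ₁ Λ₂) {t : ℝ} (ht : t ∈ Icc t₀ T)
    (x p q : Vec d) :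
    ‖N t (x + p + q) - N t (x + p) - N t (x + q) + N t x‖ ≤ Λ₂ * ‖p‖ * ‖q‖ := by
  have h2 := hN.contDiff_space t ht
  have hd : Differentiable ℝ (N t) := h2.differentiable (by norm_num)
  have hd' : Differentiable ℝ (fderiv ℝ (N t)) :=
    (h2.fderiv_right (m := 1) (by norm_num)).differentiable (by norm_num)
  have hshift : Differentiable ℝ (fun z => N t (z + p)) := hd.comp (differentiable_id.add_const p)
  have := norm_sub_le_of_norm_fderiv_le (g := fun z => N t (z + p) - N t z) (L := Λ₂ * ‖p‖)
    (hshift.sub hd) (fun z => ?_) (x + q) x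
  · rw [add_sub_cancel_left] at this
    refine le_trans (le_of_eq ?_) this
    rw [add_right_comm x q p]
    congr 1; abel
  · rw [fderiv_fun_sub (hshift z) (hd z), fderiv_comp_add_right]
    simpa using norm_sub_le_of_norm_fderiv_le hd' (hN.norm_fderiv_fderiv_le t ht) (z + p) z

lemma isSolution_flow (hN : DriftAssumption t₀ T N Λ₁ Λ₂) {s : ℝ} (hs : s ∈ Icc t₀ T) (x : Vec d) :
    IsSolution t₀ T N s x (fun t => flow t₀ T N s t x) :=
  let ⟨_, h⟩ := hN.exists_caratheodoryField
  h.isSolution_solution hs x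

lemma flow_self (hN : DriftAssumption t₀ T N Λ₁ Λ₂) {s : ℝ} (hs : s ∈ Icc t₀ T) (x : Vec d) :
    flow t₀ T N s s x = x :=
  (hN.isSolution_flow hs x).apply_self hs

lemma norm_flow_sub_le (hN : DriftAssumption t₀ T N Λ₁ Λ₂) {s t : ℝ} (hs : s ∈ Icc t₀ T)
    (ht : t ∈ Icc t₀ T) (x y : Vec d) :
    ‖flow t₀ T N s t x - flow t₀ T N s t y‖ ≤ gronwallConst Λ₁ (T - t₀) * ‖x - y‖ := by
  obtain ⟨M, h⟩ := hN.exists_caratheodoryField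
  have := (hN.isSolution_flow hs x).norm_sub_le h hs hs (hN.isSolution_flow hs y) hs ht
  simpa only [hN.flow_self hs] using this

lemma norm_flow_mixed_difference_le (hN : DriftAssumption t₀ T N Λ₁ Λ₂) {s t : ℝ}
    (hs : s ∈ Icc t₀ T) (ht : t ∈ Icc t₀ T) (x h k : Vec d) :
    ‖flow t₀ T N s t (x + h + k) - flow t₀ T N s t (x + h) - flow t₀ T N s t (x + k)
      + flow t₀ T N s t x‖ ≤ gronwallConst Λ₁ (T - t₀) *
        (Λ₂ * gronwallConst Λ₁ (T - t₀) ^ 2 * (T - t₀)) * ‖h‖ * ‖k‖ := by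
  obtain ⟨M, hF⟩ := hN.exists_caratheodoryField
  have hT : 0 ≤ T - t₀ := by linarith [hs.1, hs.2]
  have hG := gronwallConst_nonneg hF.nonneg hT
  set G := gronwallConst Λ₁ (T - t₀) with hGdef
  have hΛ₂ := hN.Λ₂_pos.le
  set a := fun t => flow t₀ T N s t (x + h + k)
  set b := fun t => flow t₀ T N s t (x + h)
  set c := fun t => flow t₀ T N s t (x + k)
  set e := fun t => flow t₀ T N s t x
  have ha : IsSolution t₀ T N s (x + h + k) a := hN.isSolution_flow hs _
  have hb : IsSolution t₀ T N s (x + h) b := hN.isSolution_flow hs _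
  have hc : IsSolution t₀ T N s (x + k) c := hN.isSolution_flow hs _
  have he : IsSolution t₀ T N s x e := hN.isSolution_flow hs _
  have hcont : ContinuousOn (fun t => ‖a t - b t - c t + e t‖) (Icc t₀ T) :=
    ((((ha.continuousOn hs).sub (hb.continuousOn hs)).sub (hc.continuousOn hs)).add
      (he.continuousOn hs)).norm
  set D := Λ₂ * G ^ 2 * ‖h‖ * ‖k‖ with hD
  have hD0 : 0 ≤ D := by positivity
  have hpt : ∀ᵐ r ∂(timeMeasure t₀ T), ‖(N r (a r) - N r (b r)) - (N r (c r) - N r (e r))‖ ≤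
      Λ₁ * ‖a r - b r - c r + e r‖ + D := by
    filter_upwards [hF.lipschitz, ae_mem_Icc] with r h1 hr
    have h2 := h1 (a r) (e r + (b r - e r) + (c r - e r))
    have h3 := hN.norm_mixed_difference_le hr (e r) (b r - e r) (c r - e r)
    have hbe : ‖b r - e r‖ ≤ G * ‖h‖ := by
      simpa using hN.norm_flow_sub_le hs hr (x + h) x
    have hce : ‖c r - e r‖ ≤ G * ‖k‖ := by
      simpa using hN.norm_flow_sub_le hs hr (x + k) x
    have h4 : Λ₂ * ‖b r - e r‖ * ‖c r - e r‖ ≤ D := by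
      calc Λ₂ * ‖b r - e r‖ * ‖c r - e r‖ ≤ Λ₂ * (G * ‖h‖) * (G * ‖k‖) := by gcongr
        _ = D := by rw [hD]; ring
    rw [show a r - (e r + (b r - e r) + (c r - e r)) = a r - b r - c r + e r by abel] at h2
    have h5 : e r + (b r - e r) = b r := by abel
    have h6 : e r + (c r - e r) = c r := by abel
    rw [h6] at h3
    nth_rewrite 2 [h5] at h3
    calc _ = ‖(N r (a r) - N r (e r + (b r - e r) + (c r - e r))) +
          (N r (e r + (b r - e r) + (c r - e r)) - N r (b r) - N r (c r) + N r (e r))‖ := by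
          congr 1; abel
      _ ≤ _ := (norm_add_le _ _).trans (add_le_add h2 (h3.trans h4))
  have := le_gronwallConst_mul (s := s) (c := D * (T - t₀)) hF.nonneg (by positivity) hcont
    (fun _ _ => norm_nonneg _) hs (fun r hr => ?_) ht
  · refine this.trans_eq ?_
    rw [hD]; ring
  · have hid : a r - b r - c r + e r = (∫ q in s..r, (N q (a q) - N q (b q))) -
        ∫ q in s..r, (N q (c q) - N q (e q)) := by
      rw [intervalIntegral.integral_sub (ha.intervalIntegrable hs hr) (hb.intervalIntegrable hs hr),
        intervalIntegral.integral_sub (hc.intervalIntegrable hs hr) (he.intervalIntegrable hs hr),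
        ha.2 r hr, hb.2 r hr, hc.2 r hr, he.2 r hr]
      abel
    rw [hid]
    refine (norm_integral_sub_le hs hr
      ((ha.intervalIntegrable hs hr).sub (hb.intervalIntegrable hs hr))
      ((hc.intervalIntegrable hs hr).sub (he.intervalIntegrable hs hr))
      (φ := fun r => Λ₁ * ‖a r - b r - c r + e r‖ + D)
      ((continuousOn_const.mul hcont).add continuousOn_const) hpt).trans ?_
    have hint : IntervalIntegrable (fun r => ‖a r - b r - c r + e r‖) volume s r :=
      (hcont.mono (uIcc_subset_Icc hs hr)).intervalIntegrable
    rw [intervalIntegral.integral_add (hint.const_mul Λ₁) intervalIntegrable_const,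
      intervalIntegral.integral_const_mul, intervalIntegral.integral_const, smul_eq_mul, add_comm]
    refine (abs_add_le _ _).trans (add_le_add ?_ ?_)
    · rw [abs_mul, abs_of_nonneg hD0, mul_comm]
      refine mul_le_mul_of_nonneg_left ?_ hD0
      rw [abs_le]
      exact ⟨by linarith [hr.1, hs.2], by linarith [hr.2, hs.1]⟩
    · rw [abs_mul, abs_of_nonneg hF.nonneg]

lemma differentiable_flow (hN : DriftAssumption t₀ T N Λ₁ Λ₂) {s t : ℝ}
    (hs : s ∈ Icc t₀ T) (ht : t ∈ Icc t₀ T) : Differentiable ℝ (flow t₀ T N s t) := fun x =>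
  let ⟨_, hA⟩ := exists_hasFDerivAt_of_mixed_difference_le (hN.norm_flow_sub_le hs ht)
    (hN.norm_flow_mixed_difference_le hs ht) x
  hA.differentiableAt

lemma norm_fderiv_flow_le (hN : DriftAssumption t₀ T N Λ₁ Λ₂) {s t : ℝ}
    (hs : s ∈ Icc t₀ T) (ht : t ∈ Icc t₀ T) (x : Vec d) :
    ‖fderiv ℝ (flow t₀ T N s t) x‖ ≤ gronwallConst Λ₁ (T - t₀) :=
  norm_fderiv_le_of_lip' ℝ (gronwallConst_nonneg hN.Λ₁_pos.le (by linarith [hs.1, hs.2]))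
    (Eventually.of_forall fun y => hN.norm_flow_sub_le hs ht y x)

lemma continuous_fderiv_flow (hN : DriftAssumption t₀ T N Λ₁ Λ₂) {s t : ℝ}
    (hs : s ∈ Icc t₀ T) (ht : t ∈ Icc t₀ T) : Continuous (fderiv ℝ (flow t₀ T N s t)) := by
  have hT : 0 ≤ T - t₀ := by linarith [hs.1, hs.2]
  have := gronwallConst_nonneg hN.Λ₁_pos.le hT
  have := hN.Λ₂_pos
  exact continuous_of_norm_sub_le (norm_fderiv_sub_le_of_mixed_difference_le
    (hN.differentiable_flow hs ht) (by positivity) (hN.norm_flow_mixed_difference_le hs ht))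

lemma continuousOn_flow_comp (hN : DriftAssumption t₀ T N Λ₁ Λ₂) {τ : ℝ} (hτ : τ ∈ Icc t₀ T)
    {c : ℝ → Vec d} (hc : ContinuousOn c (Icc t₀ T)) :
    ContinuousOn (fun t => flow t₀ T N t τ (c t)) (Icc t₀ T) := by
  obtain ⟨M, hF⟩ := hN.exists_caratheodoryField
  intro t ht
  have hz : ContinuousOn (fun s => flow t₀ T N t s (c t)) (Icc t₀ T) :=
    (hN.isSolution_flow ht (c t)).continuousOn ht
  rw [ContinuousWithinAt, tendsto_iff_norm_sub_tendsto_zero]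
  have hle : ∀ s ∈ Icc t₀ T, ‖flow t₀ T N s τ (c s) - flow t₀ T N t τ (c t)‖ ≤
      gronwallConst Λ₁ (T - t₀) * ‖c s - flow t₀ T N t s (c t)‖ := fun s hs => by
    have := (hN.isSolution_flow hs (c s)).norm_sub_le hF hs ht (hN.isSolution_flow ht (c t)) hs hτ
    simpa only [hN.flow_self hs] using this
  have hlim : Tendsto (fun s => gronwallConst Λ₁ (T - t₀) * ‖c s - flow t₀ T N t s (c t)‖)
      (𝓝[Icc t₀ T] t) (𝓝 0) := by
    have := (((hc t ht).sub (hz t ht)).norm).const_mul (gronwallConst Λ₁ (T - t₀))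
    simpa [ContinuousWithinAt, hN.flow_self ht] using this
  exact squeeze_zero' (Eventually.of_forall fun _ => norm_nonneg _)
    (eventually_mem_nhdsWithin.mono hle) hlim

lemma aestronglyMeasurable_fderiv_flow (hN : DriftAssumption t₀ T N Λ₁ Λ₂) {τ : ℝ}
    (hτ : τ ∈ Icc t₀ T) {c : ℝ → Vec d} (hc : ContinuousOn c (Icc t₀ T)) :
    AEStronglyMeasurable (fun t => fderiv ℝ (flow t₀ T N t τ) (c t)) (timeMeasure t₀ T) := by
  refine aestronglyMeasurable_of_forall_apply fun v => ?_
  refine aestronglyMeasurable_of_tendsto_ae atTop (f := fun (n : ℕ) t =>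
    (n : ℝ) • (flow t₀ T N t τ (c t + (n : ℝ)⁻¹ • v) - flow t₀ T N t τ (c t))) (fun n => ?_) ?_
  · exact ((aestronglyMeasurable_of_continuousOn (hN.continuousOn_flow_comp hτ
      (hc.add continuousOn_const))).sub (aestronglyMeasurable_of_continuousOn
      (hN.continuousOn_flow_comp hτ hc))).const_smul (n : ℝ)
  · filter_upwards [ae_mem_Icc] with t ht
    exact ((hN.differentiable_flow ht hτ (c t)).hasFDerivAt.lim_real v).comp
      tendsto_natCast_atTop_atTop

end DriftAssumption

end Flow

/-! ### The input matrix -/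

section Input

variable {d k : ℕ} {t₀ T Λ₁ Λ₂ : ℝ} {N : ℝ → Vec d → Vec d} {B : ℝ → Vec d → Mat d k}

namespace InputAssumption

lemma ae_norm_le (hB : InputAssumption t₀ T B) :
    ∀ᵐ t ∂(timeMeasure t₀ T), ∀ x, ‖B t x‖ ≤ inputNorm t₀ T B := by
  have h : ∀ᵐ p ∂((timeMeasure t₀ T).prod volume), ‖B p.1 p.2‖ ≤ inputNorm t₀ T B := by
    filter_upwards [ae_le_eLpNormEssSup (f := fun p : ℝ × Vec d => B p.1 p.2)
      (μ := (timeMeasure t₀ T).prod volume)] with p hp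
    rw [← toReal_enorm]
    refine ENNReal.toReal_mono hB.memLp.2.ne ?_
    rwa [eLpNorm_exponent_top]
  filter_upwards [Measure.ae_ae_of_ae_prod h, ae_mem_Icc] with t ht htI x
  have hclosed : IsClosed {x | ‖B t x‖ ≤ inputNorm t₀ T B} :=
    isClosed_le (hB.contDiff_space t htI).continuous.norm continuous_const
  exact hclosed.closure_subset (Measure.dense_of_ae ht x)

lemma aestronglyMeasurable (hB : InputAssumption t₀ T B) (x : Vec d) :
    AEStronglyMeasurable (fun t => B t x) (timeMeasure t₀ T) := by
  have hdense := Measure.dense_of_ae (hB.memLp.1.prodMk_right)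
  obtain ⟨xs, hxs, hlim⟩ := mem_closure_iff_seq_limit.1 (hdense x)
  refine aestronglyMeasurable_of_tendsto_ae atTop hxs ?_
  filter_upwards [ae_mem_Icc] with t ht
  exact ((hB.contDiff_space t ht).continuous.tendsto x).comp hlim

lemma aestronglyMeasurable_comp (hB : InputAssumption t₀ T B) {c : ℝ → Vec d}
    (hc : ContinuousOn c (Icc t₀ T)) :
    AEStronglyMeasurable (fun t => B t (c t)) (timeMeasure t₀ T) :=
  aestronglyMeasurable_comp_of_continuous hB.aestronglyMeasurable
    (ae_mem_Icc.mono fun t ht => (hB.contDiff_space t ht).continuous)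
    (aestronglyMeasurable_of_continuousOn hc)

end InputAssumption

lemma aestronglyMeasurable_clm_apply {α E F : Type*} [MeasurableSpace α] {μ : Measure α}
    [NormedAddCommGroup E] [NormedSpace ℝ E] [NormedAddCommGroup F] [NormedSpace ℝ F]
    {A : α → E →L[ℝ] F} {v : α → E}
    (hA : AEStronglyMeasurable A μ) (hv : AEStronglyMeasurable v μ) :
    AEStronglyMeasurable (fun a => A a (v a)) μ :=
  isBoundedBilinearMap_apply.continuous.comp_aestronglyMeasurable (hA.prodMk hv)

lemma norm_clm_apply_le {E F : Type*} [NormedAddCommGroup E] [NormedSpace ℝ E]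
    [NormedAddCommGroup F] [NormedSpace ℝ F] {A : E →L[ℝ] F} {v : E} {a b : ℝ}
    (hA : ‖A‖ ≤ a) (hv : ‖v‖ ≤ b) : ‖A v‖ ≤ a * b :=
  (A.le_opNorm v).trans (mul_le_mul hA hv (norm_nonneg _) ((norm_nonneg _).trans hA))

/-- The closed-loop vector fields of all controls bounded by `R` share their constants. -/
lemma exists_caratheodoryField_control (hN : DriftAssumption t₀ T N Λ₁ Λ₂)
    (hB : InputAssumption t₀ T B) {R : ℝ} (hR : 0 ≤ R) : ∃ K M, ∀ u : ℝ → Vec k,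
      AEStronglyMeasurable u (timeMeasure t₀ T) → (∀ᵐ t ∂(timeMeasure t₀ T), ‖u t‖ ≤ R) →
        CaratheodoryField t₀ T (fun t x => N t x + B t x (u t)) K M := by
  obtain ⟨M, hF⟩ := hN.exists_caratheodoryField
  obtain ⟨L, hL, hBL⟩ := hB.exists_norm_fderiv_le
  refine ⟨Λ₁ + L * R, M + inputNorm t₀ T B * R, fun u hu hub =>
    ⟨add_nonneg hF.nonneg (by positivity), fun x => (hF.aestronglyMeasurable x).add
      (aestronglyMeasurable_clm_apply (hB.aestronglyMeasurable x) hu), ?_, ?_⟩⟩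
  · filter_upwards [hF.lipschitz, hub, ae_mem_Icc] with t h1 h2 ht x y
    have h3 := norm_sub_le_of_norm_fderiv_le
      ((hB.contDiff_space t ht).differentiable (by norm_num)) (hBL t ht) x y
    calc ‖N t x + B t x (u t) - (N t y + B t y (u t))‖
        = ‖(N t x - N t y) + (B t x - B t y) (u t)‖ := by
          rw [add_sub_add_comm, sub_apply]
      _ ≤ Λ₁ * ‖x - y‖ + L * ‖x - y‖ * R :=
          (norm_add_le _ _).trans (add_le_add (h1 x y) (norm_clm_apply_le h3 h2))
      _ = _ := by ring
  · filter_upwards [hF.bound, hub, hB.ae_norm_le] with t h1 h2 h3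
    exact (norm_add_le _ _).trans (add_le_add h1 (norm_clm_apply_le (h3 0) h2))

variable {x₀ : Vec d} {τ R : ℝ} {u : ℝ → Vec k}

lemma continuousOn_trajectory (hT : t₀ ≤ T) (hN : DriftAssumption t₀ T N Λ₁ Λ₂)
    (hB : InputAssumption t₀ T B) (hR : 0 ≤ R) (hu : AEStronglyMeasurable u (timeMeasure t₀ T))
    (hub : ∀ᵐ t ∂(timeMeasure t₀ T), ‖u t‖ ≤ R) :
    ContinuousOn (trajectory t₀ T N B x₀ u) (Icc t₀ T) := by
  obtain ⟨K, M, h⟩ := exists_caratheodoryField_control hN hB hR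
  exact ((h u hu hub).isSolution_solution (left_mem_Icc.2 hT) x₀).continuousOn (left_mem_Icc.2 hT)

lemma ae_norm_kernel_le (hN : DriftAssumption t₀ T N Λ₁ Λ₂)
    (hB : InputAssumption t₀ T B) (hτ : τ ∈ Icc t₀ T) (u : ℝ → Vec k) :
    ∀ᵐ t ∂(timeMeasure t₀ T), ‖kernel t₀ T N B x₀ τ u t‖ ≤
      gronwallConst Λ₁ (T - t₀) * inputNorm t₀ T B := by
  filter_upwards [hB.ae_norm_le, ae_mem_Icc] with t h1 ht
  exact (ContinuousLinearMap.opNorm_comp_le _ _).trans (mul_le_mul (hN.norm_fderiv_flow_le ht hτ _)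
    (h1 _) (norm_nonneg _) (gronwallConst_nonneg hN.Λ₁_pos.le (by linarith [ht.1, ht.2])))

lemma aestronglyMeasurable_kernel (hN : DriftAssumption t₀ T N Λ₁ Λ₂)
    (hB : InputAssumption t₀ T B) (hτ : τ ∈ Icc t₀ T) (hR : 0 ≤ R)
    (hu : AEStronglyMeasurable u (timeMeasure t₀ T))
    (hub : ∀ᵐ t ∂(timeMeasure t₀ T), ‖u t‖ ≤ R) :
    AEStronglyMeasurable (kernel t₀ T N B x₀ τ u) (timeMeasure t₀ T) := by
  have hc := continuousOn_trajectory (x₀ := x₀) (hτ.1.trans hτ.2) hN hB hR hu hub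
  exact isBoundedBilinearMap_comp.continuous.comp_aestronglyMeasurable
    ((hN.aestronglyMeasurable_fderiv_flow hτ hc).prodMk (hB.aestronglyMeasurable_comp hc))

end Input

/-! ### Weak limits of bounded controls -/

/-- `U n` converges weakly in `L²` to `u`, and all these controls are bounded by `R`. -/
structure BoundedWeakLimit {k : ℕ} {t₀ T : ℝ} (R : ℝ) (U : ℕ → L2Control t₀ T k)
    (u : L2Control t₀ T k) : Prop where
  nonneg : 0 ≤ R
  bound : ∀ n, ∀ᵐ t ∂(timeMeasure t₀ T), ‖U n t‖ ≤ R
  bound_lim : ∀ᵐ t ∂(timeMeasure t₀ T), ‖u t‖ ≤ R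
  weak : ∀ ℓ : StrongDual ℝ (L2Control t₀ T k), Tendsto (fun n => ℓ (U n)) atTop (𝓝 (ℓ u))

section WeakLimit

variable {d k : ℕ} {t₀ T Λ₁ Λ₂ R τ : ℝ} {N : ℝ → Vec d → Vec d} {B : ℝ → Vec d → Mat d k}
  {x₀ : Vec d} {U : ℕ → L2Control t₀ T k} {u : L2Control t₀ T k}

lemma integrable_clm_apply {A : ℝ → Mat d k} {M : ℝ}
    (hA : AEStronglyMeasurable A (timeMeasure t₀ T)) (hM : ∀ᵐ t ∂(timeMeasure t₀ T), ‖A t‖ ≤ M)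
    (v : L2Control t₀ T k) : Integrable (fun t => A t (v t)) (timeMeasure t₀ T) := by
  have hv : Integrable v (timeMeasure t₀ T) := (Lp.memLp v).integrable one_le_two
  refine Integrable.mono' (hv.norm.const_mul M) (aestronglyMeasurable_clm_apply hA hv.1) ?_
  exact hM.mono fun t ht => norm_clm_apply_le ht le_rfl

lemma tendsto_integral_of_weak
    (hweak : ∀ ℓ : StrongDual ℝ (L2Control t₀ T k), Tendsto (fun n => ℓ (U n)) atTop (𝓝 (ℓ u)))
    {A : ℝ → Mat d k} {M : ℝ} (hA : AEStronglyMeasurable A (timeMeasure t₀ T))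
    (hM : ∀ᵐ t ∂(timeMeasure t₀ T), ‖A t‖ ≤ M) :
    Tendsto (fun n => ∫ t, A t (U n t) ∂(timeMeasure t₀ T)) atTop
      (𝓝 (∫ t, A t (u t) ∂(timeMeasure t₀ T))) := by
  have hcoord : ∀ w : Vec d, ∃ ℓ : StrongDual ℝ (L2Control t₀ T k), ∀ v : L2Control t₀ T k,
      inner ℝ w (∫ t, A t (v t) ∂(timeMeasure t₀ T)) = ℓ v := fun w => by
    have hg : MemLp (fun t => ContinuousLinearMap.adjoint (A t) w) 2 (timeMeasure t₀ T) := by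
      refine MemLp.of_bound (aestronglyMeasurable_clm_apply
        (ContinuousLinearMap.adjoint.continuous.comp_aestronglyMeasurable hA)
        aestronglyMeasurable_const) (M * ‖w‖) (hM.mono fun t ht => ?_)
      exact norm_clm_apply_le ((LinearIsometryEquiv.norm_map _ _).trans_le ht) le_rfl
    refine ⟨innerSL ℝ (hg.toLp _), fun v => ?_⟩
    rw [innerSL_apply_apply, L2.inner_def, ← integral_inner (integrable_clm_apply hA hM v)]
    refine integral_congr_ae ?_
    filter_upwards [hg.coeFn_toLp] with t ht
    rw [ht, ContinuousLinearMap.adjoint_inner_left]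
  set b := EuclideanSpace.basisFun (Fin d) ℝ
  suffices hlim : Tendsto (fun n => ∑ i, inner ℝ (b i) (∫ t, A t (U n t) ∂(timeMeasure t₀ T)) • b i)
      atTop (𝓝 (∑ i, inner ℝ (b i) (∫ t, A t (u t) ∂(timeMeasure t₀ T)) • b i)) by
    simpa only [b.sum_repr'] using hlim
  refine tendsto_finsetSum _ fun i _ => Tendsto.smul_const ?_ _
  obtain ⟨ℓ, hℓ⟩ := hcoord (b i)
  simp only [hℓ]
  exact hweak ℓ

lemma integral_interval_eq_integral_indicator {E : Type*} [NormedAddCommGroup E] [NormedSpace ℝ E]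
    {t : ℝ} (ht : t ∈ Icc t₀ T) (g : ℝ → E) :
    ∫ r in t₀..t, g r = ∫ r, (Ioc t₀ t).indicator g r ∂(timeMeasure t₀ T) := by
  rw [intervalIntegral.integral_of_le ht.1, integral_indicator measurableSet_Ioc, timeMeasure,
    Measure.restrict_congr_set Ioo_ae_eq_Ioc, Measure.restrict_restrict measurableSet_Ioc,
    inter_eq_left.2 (Ioc_subset_Ioc_right ht.2)]

lemma tendsto_trajectory (hN : DriftAssumption t₀ T N Λ₁ Λ₂) (hB : InputAssumption t₀ T B)
    (hU : BoundedWeakLimit R U u) {t : ℝ} (ht : t ∈ Icc t₀ T) :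
    Tendsto (fun n => trajectory t₀ T N B x₀ (U n) t) atTop
      (𝓝 (trajectory t₀ T N B x₀ u t)) := by
  have hT : t₀ ≤ T := ht.1.trans ht.2
  have h0 : t₀ ∈ Icc t₀ T := left_mem_Icc.2 hT
  obtain ⟨K, M, hF⟩ := exists_caratheodoryField_control hN hB hU.nonneg
  have hUm : ∀ n, AEStronglyMeasurable (U n) (timeMeasure t₀ T) := fun n => Lp.aestronglyMeasurable _
  have hum : AEStronglyMeasurable u (timeMeasure t₀ T) := Lp.aestronglyMeasurable _
  have hfn := fun n => hF (U n) (hUm n) (hU.bound n)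
  have hfu := hF u hum hU.bound_lim
  set x := trajectory t₀ T N B x₀ u
  have hx : IsSolution t₀ T (fun t x => N t x + B t x (u t)) t₀ x₀ x := hfu.isSolution_solution h0 x₀
  set X := fun n => trajectory t₀ T N B x₀ (U n)
  have hX : ∀ n, IsSolution t₀ T (fun t x => N t x + B t x (U n t)) t₀ x₀ (X n) := fun n =>
    (hfn n).isSolution_solution h0 x₀
  have hxc := hx.continuousOn h0
  have hXc := fun n => (hX n).continuousOn h0
  have hK : 0 ≤ K := hfu.nonneg
  have hBm := hB.aestronglyMeasurable_comp hxc
  have hBb : ∀ᵐ t ∂(timeMeasure t₀ T), ‖B t (x t)‖ ≤ inputNorm t₀ T B :=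
    hB.ae_norm_le.mono fun t h => h _
  set δ : ℕ → ℝ → Vec d := fun n r => B r (x r) (U n r) - B r (x r) (u r) with hδ
  have hδint : ∀ n, Integrable (δ n) (timeMeasure t₀ T) := fun n =>
    (integrable_clm_apply hBm hBb (U n)).sub (integrable_clm_apply hBm hBb u)
  set e : ℕ → ℝ → ℝ := fun n t => ‖∫ r in t₀..t, δ n r‖ with he
  have hec : ∀ n, ContinuousOn (e n) (Icc t₀ T) := fun n =>
    (continuousOn_integral h0 ((integrable_timeMeasure_iff hT).1 (hδint n))).norm
  have hφc : ∀ n, ContinuousOn (fun t => ‖X n t - x t‖) (Icc t₀ T) := fun n =>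
    ((hXc n).sub hxc).norm
  have hgron : ∀ n, ∀ t ∈ Icc t₀ T, ‖X n t - x t‖ ≤ e n t + K * ∫ r in t₀..t, ‖X n r - x r‖ := by
    intro n t ht
    set g : ℝ → Vec d := fun r => N r (x r) + B r (x r) (U n r)
    have hg : IntervalIntegrable g volume t₀ t := (hfn n).intervalIntegrable_comp hxc h0 ht
    have hid : X n t - x t = (∫ r in t₀..t, δ n r) +
        ((∫ r in t₀..t, (N r (X n r) + B r (X n r) (U n r))) - ∫ r in t₀..t, g r) := by
      have h1 : (∫ r in t₀..t, δ n r) = (∫ r in t₀..t, g r) -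
          ∫ r in t₀..t, (N r (x r) + B r (x r) (u r)) := by
        rw [← intervalIntegral.integral_sub hg (hx.intervalIntegrable h0 ht)]
        refine intervalIntegral.integral_congr fun r _ => ?_
        simp only [hδ, g]; abel
      rw [h1, (hX n).2 t ht, hx.2 t ht]
      abel
    rw [hid]
    refine (norm_add_le _ _).trans (add_le_add le_rfl ?_)
    refine (norm_integral_sub_le h0 ht ((hX n).intervalIntegrable h0 ht) hg
      (φ := fun r => K * ‖X n r - x r‖) (continuousOn_const.mul (hφc n))
      ((hfn n).lipschitz.mono fun r h => h _ _)).trans_eq ?_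
    rw [intervalIntegral.integral_const_mul, abs_of_nonneg]
    exact mul_nonneg hK (intervalIntegral.integral_nonneg ht.1 fun _ _ => norm_nonneg _)
  have he0 : ∀ t ∈ Icc t₀ T, Tendsto (fun n => e n t) atTop (𝓝 0) := by
    intro t ht
    have hA : AEStronglyMeasurable ((Ioc t₀ t).indicator fun r => B r (x r)) (timeMeasure t₀ T) :=
      hBm.indicator measurableSet_Ioc
    have hAb : ∀ᵐ r ∂(timeMeasure t₀ T),
        ‖(Ioc t₀ t).indicator (fun r => B r (x r)) r‖ ≤ inputNorm t₀ T B :=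
      hBb.mono fun r hr => (norm_indicator_le_norm_self _ _).trans hr
    have h1 := tendsto_integral_of_weak hU.weak hA hAb
    have h2 := (h1.sub_const (∫ r, (Ioc t₀ t).indicator (fun r => B r (x r)) r (u r)
      ∂(timeMeasure t₀ T))).norm
    rw [sub_self, norm_zero] at h2
    refine h2.congr fun n => ?_
    rw [← integral_sub (integrable_clm_apply hA hAb _) (integrable_clm_apply hA hAb _)]
    simp only [he]
    rw [integral_interval_eq_integral_indicator ht]
    congr 2
    ext r : 1
    by_cases hr : r ∈ Ioc t₀ t <;> simp [hr, hδ]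
  have heb : ∀ n, ∀ t ∈ Icc t₀ T, e n t ≤ inputNorm t₀ T B * (R + R) * |T - t₀| := by
    intro n t ht
    have hb : ∀ᵐ r ∂(timeMeasure t₀ T), ‖δ n r‖ ≤ inputNorm t₀ T B * (R + R) := by
      filter_upwards [hBb, hU.bound n, hU.bound_lim] with r h1 h2 h3
      simp only [hδ]
      rw [← map_sub]
      exact norm_clm_apply_le h1 ((norm_sub_le _ _).trans (add_le_add h2 h3))
    have h1 := intervalIntegral.norm_integral_le_of_norm_le_const_ae
      ((ae_restrict_iff' measurableSet_uIoc).1 (ae_restrict_uIoc hb h0 ht))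
    have hnn : 0 ≤ inputNorm t₀ T B * (R + R) :=
      mul_nonneg ENNReal.toReal_nonneg (add_nonneg hU.nonneg hU.nonneg)
    refine h1.trans (mul_le_mul_of_nonneg_left ?_ hnn)
    rw [abs_of_nonneg (by linarith [ht.1]), abs_of_nonneg (by linarith)]
    linarith [ht.2]
  have heint : Tendsto (fun n => ∫ r in t₀..T, e n r) atTop (𝓝 0) := by
    have := intervalIntegral.tendsto_integral_filter_of_dominated_convergence (μ := volume)
      (a := t₀) (b := T) (F := e) (f := fun _ => 0) (l := atTop)
      (fun _ => inputNorm t₀ T B * (R + R) * |T - t₀|) (Eventually.of_forall fun n => ?_)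
      (Eventually.of_forall fun n => ae_of_all _ fun r hr => ?_) intervalIntegrable_const
      (ae_of_all _ fun r hr => ?_)
    · simpa using this
    · exact ((hec n).mono (by rw [uIoc_of_le hT]; exact Ioc_subset_Icc_self)).aestronglyMeasurable
        measurableSet_uIoc
    · rw [uIoc_of_le hT] at hr
      rw [norm_norm]
      exact heb n r (Ioc_subset_Icc_self hr)
    · rw [uIoc_of_le hT] at hr
      exact he0 r (Ioc_subset_Icc_self hr)
  rw [tendsto_iff_norm_sub_tendsto_zero]
  have hlim : Tendsto (fun n => e n t + K * (Real.exp (K * (T - t₀)) * ∫ r in t₀..T, e n r)) atTop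
      (𝓝 0) := by
    simpa using (he0 t ht).add ((heint.const_mul (Real.exp (K * (T - t₀)))).const_mul K)
  exact squeeze_zero (fun _ => norm_nonneg _) (fun n => le_of_le_add_integral hK (hφc n) (hec n)
    (fun _ _ => norm_nonneg _) (hgron n) ht) hlim

lemma tendsto_kernel (hN : DriftAssumption t₀ T N Λ₁ Λ₂) (hB : InputAssumption t₀ T B)
    (hτ : τ ∈ Icc t₀ T) (hU : BoundedWeakLimit R U u) {t : ℝ} (ht : t ∈ Icc t₀ T) :
    Tendsto (fun n => kernel t₀ T N B x₀ τ (U n) t) atTop (𝓝 (kernel t₀ T N B x₀ τ u t)) := by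
  have hx := tendsto_trajectory (x₀ := x₀) hN hB hU ht
  exact (isBoundedBilinearMap_comp.continuous.tendsto (_, _)).comp
    ((((hN.continuous_fderiv_flow ht hτ).tendsto _).comp hx).prodMk_nhds
      (((hB.contDiff_space t ht).continuous.tendsto _).comp hx))

/-- The integrand of the Gramian depends continuously on the kernel. -/
lemma continuous_comp_adjoint : Continuous fun A : Mat d k =>
    A.comp (ContinuousLinearMap.adjoint A) :=
  isBoundedBilinearMap_comp.continuous.comp
    (continuous_id.prodMk ContinuousLinearMap.adjoint.continuous)

lemma integrable_gramian (hN : DriftAssumption t₀ T N Λ₁ Λ₂) (hB : InputAssumption t₀ T B)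
    (hτ : τ ∈ Icc t₀ T) (hR : 0 ≤ R) {u : ℝ → Vec k}
    (hu : AEStronglyMeasurable u (timeMeasure t₀ T))
    (hub : ∀ᵐ t ∂(timeMeasure t₀ T), ‖u t‖ ≤ R) :
    Integrable (fun t => (kernel t₀ T N B x₀ τ u t).comp
      (ContinuousLinearMap.adjoint (kernel t₀ T N B x₀ τ u t))) (timeMeasure t₀ T) := by
  refine Integrable.of_bound (continuous_comp_adjoint.comp_aestronglyMeasurable
    (aestronglyMeasurable_kernel hN hB hτ hR hu hub))
    ((gronwallConst Λ₁ (T - t₀) * inputNorm t₀ T B) ^ 2) ?_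
  filter_upwards [ae_norm_kernel_le (x₀ := x₀) hN hB hτ u] with t ht
  refine (ContinuousLinearMap.opNorm_comp_le _ _).trans ?_
  rw [LinearIsometryEquiv.norm_map, ← sq]
  gcongr

lemma tendsto_gramian (hN : DriftAssumption t₀ T N Λ₁ Λ₂) (hB : InputAssumption t₀ T B)
    (hτ : τ ∈ Icc t₀ T) (hU : BoundedWeakLimit R U u) :
    Tendsto (fun n => gramian t₀ T N B x₀ τ (U n)) atTop (𝓝 (gramian t₀ T N B x₀ τ u)) := by
  refine tendsto_integral_of_dominated_convergence
    (fun _ => (gronwallConst Λ₁ (T - t₀) * inputNorm t₀ T B) ^ 2)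
    (fun n => (integrable_gramian hN hB hτ hU.nonneg (Lp.aestronglyMeasurable _) (hU.bound n)).1)
    (integrable_const _) (fun n => ?_) ?_
  · filter_upwards [ae_norm_kernel_le (x₀ := x₀) hN hB hτ (U n)] with t ht
    refine (ContinuousLinearMap.opNorm_comp_le _ _).trans ?_
    rw [LinearIsometryEquiv.norm_map, ← sq]
    gcongr
  · filter_upwards [ae_mem_Icc] with t ht
    exact (continuous_comp_adjoint.tendsto _).comp (tendsto_kernel hN hB hτ hU ht)

lemma tendsto_steeringOp (hN : DriftAssumption t₀ T N Λ₁ Λ₂) (hB : InputAssumption t₀ T B)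
    (hτ : τ ∈ Icc t₀ T) (hU : BoundedWeakLimit R U u) :
    Tendsto (fun n => steeringOp t₀ T N B x₀ τ (U n) (U n)) atTop
      (𝓝 (steeringOp t₀ T N B x₀ τ u u)) := by
  have hmU := fun n => aestronglyMeasurable_kernel (x₀ := x₀) hN hB hτ hU.nonneg
    (Lp.aestronglyMeasurable (U n)) (hU.bound n)
  have hmu := aestronglyMeasurable_kernel (x₀ := x₀) hN hB hτ hU.nonneg
    (Lp.aestronglyMeasurable u) hU.bound_lim
  set c := gronwallConst Λ₁ (T - t₀) * inputNorm t₀ T B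
  have hbU : ∀ n, ∀ᵐ t ∂(timeMeasure t₀ T), ‖kernel t₀ T N B x₀ τ (U n) t‖ ≤ c := fun n =>
    ae_norm_kernel_le hN hB hτ (U n)
  have hbu : ∀ᵐ t ∂(timeMeasure t₀ T), ‖kernel t₀ T N B x₀ τ u t‖ ≤ c :=
    ae_norm_kernel_le hN hB hτ u
  have h1 : Tendsto (fun n => ∫ t, (kernel t₀ T N B x₀ τ (U n) t (U n t) -
      kernel t₀ T N B x₀ τ u t (U n t)) ∂(timeMeasure t₀ T)) atTop (𝓝 0) := by
    have := tendsto_integral_of_dominated_convergence (μ := timeMeasure t₀ T)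
      (F := fun n t => kernel t₀ T N B x₀ τ (U n) t (U n t) - kernel t₀ T N B x₀ τ u t (U n t))
      (f := fun _ => 0) (fun _ => (c + c) * R)
      (fun n => ((integrable_clm_apply (hmU n) (hbU n) (U n)).sub
        (integrable_clm_apply hmu hbu (U n))).1) (integrable_const _) (fun n => ?_) ?_
    · simpa using this
    · filter_upwards [hbU n, hbu, hU.bound n] with t h1 h2 h3
      rw [← sub_apply]
      exact norm_clm_apply_le ((norm_sub_le _ _).trans (add_le_add h1 h2)) h3
    · filter_upwards [ae_mem_Icc, ae_all_iff.2 hU.bound] with t ht hb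
      have hk := (tendsto_iff_norm_sub_tendsto_zero.1
        (tendsto_kernel (x₀ := x₀) hN hB hτ hU ht)).mul_const R
      rw [zero_mul] at hk
      refine squeeze_zero_norm (fun n => ?_) hk
      rw [← sub_apply]
      exact norm_clm_apply_le le_rfl (hb n)
  have h2 := h1.add (tendsto_integral_of_weak hU.weak hmu hbu)
  rw [zero_add] at h2
  refine h2.congr fun n => ?_
  rw [integral_sub (integrable_clm_apply (hmU n) (hbU n) (U n))
    (integrable_clm_apply hmu hbu (U n)), sub_add_cancel]
  rfl

end WeakLimit

/-! ### The smallest eigenvalue -/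

section LambdaMin

variable {d : ℕ} {A : Mat d d}

lemma le_lambdaMin_iff [Nontrivial (Vec d)] (hA : (A : Vec d →ₗ[ℝ] Vec d).IsSymmetric) {c : ℝ} :
    c ≤ lambdaMin A ↔ ∀ x, c * ‖x‖ ^ 2 ≤ inner ℝ (A x) x := by
  have heig : ∀ {c' : ℝ}, Module.End.HasEigenvalue (A : Vec d →ₗ[ℝ] Vec d) c' →
      ∃ v : Vec d, 0 < ‖v‖ ^ 2 ∧ inner ℝ (A v) v = c' * ‖v‖ ^ 2 := fun {c'} h => by
    obtain ⟨v, hv⟩ := h.exists_hasEigenvector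
    refine ⟨v, by have := norm_pos_iff.2 hv.2; positivity, ?_⟩
    have : A v = c' • v := hv.apply_eq_smul
    rw [this, real_inner_smul_left, real_inner_self_eq_norm_sq]
  have habs : ∀ x : Vec d, -‖A‖ * ‖x‖ ^ 2 ≤ inner ℝ (A x) x := fun x => by
    have h1 := abs_real_inner_le_norm (A x) x
    have h2 := mul_le_mul_of_nonneg_right (A.le_opNorm x) (norm_nonneg x)
    have h3 := neg_abs_le (inner ℝ (A x) x)
    nlinarith
  have hray := hA.hasEigenvalue_iInf_of_finiteDimensional
  constructor
  · intro h x
    rcases eq_or_ne x 0 with rfl | hx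
    · simp
    have hbdd : BddBelow {c : ℝ | Module.End.HasEigenvalue (A : Vec d →ₗ[ℝ] Vec d) c} := by
      refine ⟨-‖A‖, fun c' hc' => ?_⟩
      obtain ⟨v, hv, hvc⟩ := heig hc'
      exact le_of_mul_le_mul_right ((habs v).trans_eq hvc) hv
    have h1 := h.trans (csInf_le hbdd hray)
    have hx2 : 0 < ‖x‖ ^ 2 := by have := norm_pos_iff.2 hx; positivity
    have h2 := h1.trans (ciInf_le (f := fun x : { x : Vec d // x ≠ 0 } =>
      RCLike.re (inner ℝ (A x) (x : Vec d)) / ‖(x : Vec d)‖ ^ 2) ⟨-‖A‖, ?_⟩ ⟨x, hx⟩)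
    · exact (le_div_iff₀ hx2).1 h2
    · rintro _ ⟨z, rfl⟩
      have hz : 0 < ‖(z : Vec d)‖ ^ 2 := by have := norm_pos_iff.2 z.2; positivity
      exact (le_div_iff₀ hz).2 (habs z)
  · intro h
    refine le_csInf ⟨_, hray⟩ fun c' hc' => ?_
    obtain ⟨v, hv, hvc⟩ := heig hc'
    exact le_of_mul_le_mul_right ((h v).trans_eq hvc) hv

lemma lambdaMin_of_subsingleton [Subsingleton (Vec d)] : lambdaMin A = 0 := by
  have : {c : ℝ | Module.End.HasEigenvalue (A : Vec d →ₗ[ℝ] Vec d) c} = ∅ := by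
    refine eq_empty_of_forall_notMem fun c hc => ?_
    obtain ⟨v, hv⟩ := Module.End.HasEigenvalue.exists_hasEigenvector hc
    exact hv.2 (Subsingleton.elim _ _)
  rw [lambdaMin, this, Real.sInf_empty]

end LambdaMin

section Gramian

variable {d k : ℕ} {t₀ T Λ₁ Λ₂ R τ : ℝ} {N : ℝ → Vec d → Vec d} {B : ℝ → Vec d → Mat d k}
  {x₀ : Vec d} {U : ℕ → L2Control t₀ T k} {u : L2Control t₀ T k}

lemma isSymmetric_gramian (hN : DriftAssumption t₀ T N Λ₁ Λ₂) (hB : InputAssumption t₀ T B)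
    (hτ : τ ∈ Icc t₀ T) (hR : 0 ≤ R) {u : ℝ → Vec k}
    (hu : AEStronglyMeasurable u (timeMeasure t₀ T))
    (hub : ∀ᵐ t ∂(timeMeasure t₀ T), ‖u t‖ ≤ R) :
    (gramian t₀ T N B x₀ τ u : Vec d →ₗ[ℝ] Vec d).IsSymmetric := by
  have hint := integrable_gramian (x₀ := x₀) hN hB hτ hR hu hub
  have key : ∀ x y : Vec d, inner ℝ x (gramian t₀ T N B x₀ τ u y) =
      ∫ t, inner ℝ (ContinuousLinearMap.adjoint (kernel t₀ T N B x₀ τ u t) x)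
        (ContinuousLinearMap.adjoint (kernel t₀ T N B x₀ τ u t) y) ∂(timeMeasure t₀ T) := by
    intro x y
    rw [gramian, ContinuousLinearMap.integral_apply hint,
      ← integral_inner (hint.apply_continuousLinearMap y)]
    simp only [ContinuousLinearMap.comp_apply, ContinuousLinearMap.adjoint_inner_left]
  intro x y
  rw [ContinuousLinearMap.coe_coe, real_inner_comm, key, key]
  simp only [real_inner_comm]

lemma le_lambdaMin_gramian_of_weak (hN : DriftAssumption t₀ T N Λ₁ Λ₂)
    (hB : InputAssumption t₀ T B) (hτ : τ ∈ Icc t₀ T) (hU : BoundedWeakLimit R U u)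
    [Nontrivial (Vec d)] {c : ℝ}
    (h : ∀ n, c ≤ lambdaMin (gramian t₀ T N B x₀ τ (U n))) :
    c ≤ lambdaMin (gramian t₀ T N B x₀ τ u) := by
  have hlim := tendsto_gramian (x₀ := x₀) hN hB hτ hU
  rw [le_lambdaMin_iff (isSymmetric_gramian hN hB hτ hU.nonneg (Lp.aestronglyMeasurable _)
    hU.bound_lim)]
  intro x
  have hx : Tendsto (fun n => inner ℝ (gramian t₀ T N B x₀ τ (U n) x) x) atTop
      (𝓝 (inner ℝ (gramian t₀ T N B x₀ τ u x) x)) :=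
    (((ContinuousLinearMap.apply ℝ (Vec d) x).continuous.tendsto _).comp hlim).inner
      tendsto_const_nhds
  exact ge_of_tendsto' hx fun n => (le_lambdaMin_iff (isSymmetric_gramian hN hB hτ hU.nonneg
    (Lp.aestronglyMeasurable _) (hU.bound n))).1 (h n) x

end Gramian

/-! ### Weak sequential closedness and minimizers -/

section Weak

lemma mem_of_weak_limit {H : Type*} [NormedAddCommGroup H] [NormedSpace ℝ H] {S : Set H}
    (hS : Convex ℝ S) (hSc : IsClosed S) {U : ℕ → H} {u : H} (hU : ∀ n, U n ∈ S)
    (hweak : ∀ ℓ : StrongDual ℝ H, Tendsto (fun n => ℓ (U n)) atTop (𝓝 (ℓ u))) : u ∈ S := by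
  by_contra hu
  obtain ⟨ℓ, c, hc, hSℓ⟩ := geometric_hahn_banach_point_closed hS hSc hu
  exact absurd (ge_of_tendsto' (hweak ℓ) fun n => (hSℓ _ (hU n)).le) (not_le.2 hc)

/-- A nonempty weakly sequentially closed set of a separable Hilbert space has an element of
minimal norm. -/
lemma exists_norm_le_of_weak_isSeqClosed {H : Type*} [NormedAddCommGroup H]
    [InnerProductSpace ℝ H] [CompleteSpace H] [TopologicalSpace.SeparableSpace H] {S : Set H}
    (hS : S.Nonempty)
    (hclosed : ∀ (U : ℕ → H) (u : H), (∀ n, U n ∈ S) →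
      (∀ ℓ : StrongDual ℝ H, Tendsto (fun n => ℓ (U n)) atTop (𝓝 (ℓ u))) → u ∈ S) :
    ∃ u ∈ S, ∀ v ∈ S, ‖u‖ ≤ ‖v‖ := by
  have hbdd : BddBelow (norm '' S) := ⟨0, by rintro _ ⟨v, -, rfl⟩; exact norm_nonneg v⟩
  obtain ⟨a, -, ha, haS⟩ := exists_seq_tendsto_sInf (hS.image norm) hbdd
  choose U hUS hUa using haS
  set m := sInf (norm '' S)
  have hnorm : Tendsto (fun n => ‖U n‖) atTop (𝓝 m) := by simpa only [hUa] using ha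
  obtain ⟨r, hr⟩ := hnorm.bddAbove_range
  obtain ⟨φ, -, σ, hσ, hφ⟩ := WeakDual.isSeqCompact_closedBall ℝ H 0 r
    (x := fun n => StrongDual.toWeakDual (innerSL ℝ (U n))) (fun n => by
      simpa using hr (mem_range_self n))
  obtain ⟨u, hu⟩ := (InnerProductSpace.toDual ℝ H).surjective (WeakDual.toStrongDual φ)
  have hinner : ∀ v, Tendsto (fun n => inner ℝ (U (σ n)) v) atTop (𝓝 (inner ℝ u v)) := fun v => by
    have h1 := ((WeakDual.eval_continuous v).tendsto φ).comp hφ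
    have h2 : φ v = inner ℝ u v := by
      rw [← InnerProductSpace.toDual_apply_apply, hu]; rfl
    rw [← h2]
    exact h1
  have huS : u ∈ S := by
    refine hclosed (fun n => U (σ n)) u (fun n => hUS _) fun ℓ => ?_
    obtain ⟨w, rfl⟩ := (InnerProductSpace.toDual ℝ H).surjective ℓ
    simpa only [InnerProductSpace.toDual_apply_apply, real_inner_comm] using hinner w
  refine ⟨u, huS, fun v hv => le_trans ?_ (csInf_le hbdd (mem_image_of_mem norm hv))⟩
  have hle : ‖u‖ * ‖u‖ ≤ m * ‖u‖ := by
    rw [← real_inner_self_eq_norm_mul_norm]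
    exact le_of_tendsto_of_tendsto' (hinner u)
      ((hnorm.comp hσ.tendsto_atTop).mul_const ‖u‖) fun n => real_inner_le_norm _ _
  rcases (norm_nonneg u).eq_or_lt with h0 | h0
  · rw [← h0]
    exact le_csInf (hS.image norm) (by rintro _ ⟨v, -, rfl⟩; exact norm_nonneg v)
  · exact le_of_mul_le_mul_right hle h0

variable {d k : ℕ} {t₀ T : ℝ}

lemma convex_bounded_controls (R : ℝ) :
    Convex ℝ {v : L2Control t₀ T k | ∀ᵐ t ∂(timeMeasure t₀ T), ‖v t‖ ≤ R} := by
  intro v hv w hw a b ha hb hab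
  filter_upwards [hv, hw, Lp.coeFn_add (a • v) (b • w), Lp.coeFn_smul a v, Lp.coeFn_smul b w]
    with t h1 h2 h3 h4 h5
  rw [h3, Pi.add_apply, h4, h5, Pi.smul_apply, Pi.smul_apply]
  have := convex_closedBall (0 : Vec k) R (mem_closedBall_zero_iff.2 h1)
    (mem_closedBall_zero_iff.2 h2) ha hb hab
  exact mem_closedBall_zero_iff.1 this

lemma isClosed_bounded_controls (R : ℝ) :
    IsClosed {v : L2Control t₀ T k | ∀ᵐ t ∂(timeMeasure t₀ T), ‖v t‖ ≤ R} := by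
  refine IsSeqClosed.isClosed fun U u hU hlim => ?_
  obtain ⟨σ, -, hσ⟩ := (tendstoInMeasure_of_tendsto_Lp hlim).exists_seq_tendsto_ae
  filter_upwards [hσ, ae_all_iff.2 hU] with t h1 h2
  exact le_of_tendsto' h1.norm fun n => h2 _

lemma eLpNorm_top_le_ofReal_iff {α E : Type*} [MeasurableSpace α] {μ : Measure α}
    [NormedAddCommGroup E] {v : α → E} {r : ℝ} (hr : 0 ≤ r) :
    eLpNorm v ∞ μ ≤ ENNReal.ofReal r ↔ ∀ᵐ t ∂μ, ‖v t‖ ≤ r := by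
  rw [eLpNorm_exponent_top]
  refine ⟨fun h => ?_, eLpNormEssSup_le_of_ae_bound⟩
  filter_upwards [ae_le_eLpNormEssSup (f := v) (μ := μ)] with t ht
  have := ht.trans h
  rwa [← ofReal_norm, ENNReal.ofReal_le_ofReal_iff hr] at this

variable {Λ₁ Λ₂ C : ℝ} {N : ℝ → Vec d → Vec d} {B : ℝ → Vec d → Mat d k}
  {x₀ y : Vec d} {i : Fin 2} {U : ℕ → L2Control t₀ T k} {u : L2Control t₀ T k}

lemma radius_nonneg (hC : 0 ≤ C) : 0 ≤ radius t₀ T B Λ₁ C y := by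
  have : 0 ≤ inputNorm t₀ T B := ENNReal.toReal_nonneg
  unfold radius; positivity

lemma refTime_mem_Icc (hT : t₀ ≤ T) : refTime t₀ T i ∈ Icc t₀ T := by
  fin_cases i <;> simp [refTime, hT]

lemma mem_feasibleSet_of_weak_limit [Nontrivial (Vec d)] (hT : t₀ ≤ T)
    (hN : DriftAssumption t₀ T N Λ₁ Λ₂) (hB : InputAssumption t₀ T B) (hC : 0 ≤ C)
    (hU : ∀ n, U n ∈ feasibleSet t₀ T N B x₀ Λ₁ i C y)
    (hweak : ∀ ℓ : StrongDual ℝ (L2Control t₀ T k),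
      Tendsto (fun n => ℓ (U n)) atTop (𝓝 (ℓ u))) :
    u ∈ feasibleSet t₀ T N B x₀ Λ₁ i C y := by
  have hr : 0 ≤ radius t₀ T B Λ₁ C y := radius_nonneg hC
  have hτ : refTime t₀ T i ∈ Icc t₀ T := refTime_mem_Icc hT
  have hbound := fun n => (eLpNorm_top_le_ofReal_iff hr).1 (hU n).1.2
  have hbound_lim : ∀ᵐ t ∂(timeMeasure t₀ T), ‖u t‖ ≤ radius t₀ T B Λ₁ C y :=
    mem_of_weak_limit (convex_bounded_controls _) (isClosed_bounded_controls _) hbound hweak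
  have hlim : BoundedWeakLimit (radius t₀ T B Λ₁ C y) U u := ⟨hr, hbound, hbound_lim, hweak⟩
  refine ⟨⟨⟨MemLp.of_bound (Lp.aestronglyMeasurable u) _ hbound_lim,
    le_lambdaMin_gramian_of_weak hN hB hτ hlim fun n => (hU n).1.1.2⟩,
    (eLpNorm_top_le_ofReal_iff hr).2 hbound_lim⟩, ?_⟩
  refine tendsto_nhds_unique (tendsto_steeringOp hN hB hτ hlim) ?_
  simp only [fun n => (hU n).2, tendsto_const_nhds]

lemma tendsto_dual_of_tendsto_toWeakSpace {H : Type*} [NormedAddCommGroup H] [NormedSpace ℝ H]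
    {U : ℕ → H} {u : H}
    (h : Tendsto (fun n => toWeakSpace ℝ H (U n)) atTop (𝓝 (toWeakSpace ℝ H u)))
    (ℓ : StrongDual ℝ H) : Tendsto (fun n => ℓ (U n)) atTop (𝓝 (ℓ u)) :=
  ((WeakBilin.eval_continuous (topDualPairing ℝ H).flip ℓ).tendsto _).comp h

end Weak

end ControlAffine

end

theorem proposition3p8 {d k : ℕ} {t₀ T : ℝ} (hT : t₀ < T)
    (N : ℝ → ControlAffine.Vec d → ControlAffine.Vec d) (Λ₁ Λ₂ : ℝ)
    (hN : ControlAffine.DriftAssumption t₀ T N Λ₁ Λ₂)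
    (B : ℝ → ControlAffine.Vec d → ControlAffine.Mat d k)
    (hB : ControlAffine.InputAssumption t₀ T B)
    (x₀ : ControlAffine.Vec d) (i : Fin 2) (C : ℝ) (hC : 0 < C)
    (hne : (ControlAffine.coercivityClass t₀ T N B x₀ i C).Nonempty)
    (y : ControlAffine.Vec d) :
    IsSeqClosed (toWeakSpace ℝ (ControlAffine.L2Control t₀ T k) ''
        ControlAffine.feasibleSet t₀ T N B x₀ Λ₁ i C y) ∧
      ((ControlAffine.feasibleSet t₀ T N B x₀ Λ₁ i C y).Nonempty →
        ∃ u ∈ ControlAffine.feasibleSet t₀ T N B x₀ Λ₁ i C y,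
          IsMinOn (fun v : ControlAffine.L2Control t₀ T k => (1 / 2 : ℝ) * ‖v‖ ^ 2)
            (ControlAffine.feasibleSet t₀ T N B x₀ Λ₁ i C y) u) := by
  have hd : Nontrivial (ControlAffine.Vec d) := by
    refine (subsingleton_or_nontrivial (ControlAffine.Vec d)).resolve_left fun h => ?_
    obtain ⟨u, -, hu⟩ := hne
    rw [ControlAffine.lambdaMin_of_subsingleton] at hu
    exact absurd (inv_pos.2 hC) (not_lt.2 hu)
  have hclosed := fun (U : ℕ → ControlAffine.L2Control t₀ T k) (u : ControlAffine.L2Control t₀ T k)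
    (hU : ∀ n, U n ∈ ControlAffine.feasibleSet t₀ T N B x₀ Λ₁ i C y) =>
    ControlAffine.mem_feasibleSet_of_weak_limit (u := u) hT.le hN hB hC.le hU
  refine ⟨fun U p hU hp => ?_, fun hF => ?_⟩
  · choose V hV hVU using hU
    obtain ⟨u, rfl⟩ := (toWeakSpace ℝ (ControlAffine.L2Control t₀ T k)).surjective p
    refine mem_image_of_mem _ (hclosed V u hV
      (ControlAffine.tendsto_dual_of_tendsto_toWeakSpace ?_))
    simpa only [hVU] using hp
  · have : Fact ((2 : ℝ≥0∞) ≠ ∞) := ⟨by simp⟩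
    obtain ⟨u, hu, hmin⟩ := ControlAffine.exists_norm_le_of_weak_isSeqClosed hF hclosed
    refine ⟨u, hu, fun v hv => ?_⟩
    have := hmin v hv
    simp only [mem_ofPred_eq]
    gcongr
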